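/- Let $n\ge 1$. For $\lambda\in(0,1)$ write $\tau=\min(\lambda,1-\lambda)$. A function $\varphi:\mathbb R^n\to[0,\infty)$ is called radial if $\varphi(x)$ depends only on the Euclidean norm $|x|$, and log-concave if $\varphi(tx+(1-t)y)\ge\varphi(x)^t\varphi(y)^{1-t}$ for all $x,y\in\mathbb R^n$ and $t\in(0,1)$. (Stability.) There is a constant $C_n>0$ depending only on $n$ such that the following holds. Let $\lambda\in(0,1)$, $\varepsilon\ge0$, and let $h,f,g:\mathbb R^n\to[0,\infty)$ be radial integrable functions with $\int f>0$ and $\int g>0$ such that $$h(\lambda x+(1-\lambda)y)\ge f(x)^\lambda g(y)^{1-\lambda}\qquad\text{for all }x,y\in\mathbb R^n .$$ Suppose that either $h$ is log-concave, or both $f$ and $g$ are log-concave, and that $$\int_{\mathbb R^n}h\le(1+\varepsilon)\Big(\int_{\mathbb R^n}f\Big)^{\lambda}\Big(\int_{\mathbb R^n}g\Big)^{1-\lambda}.$$ Then there are $a>0$ and a radial, integrable, log-concave function $\tilde h:\mathbb R^n\to[0,\infty)$ such that $$\int_{\mathbb R^n}|f-a^{1-\lambda}\tilde h|\le C_n\Big(\frac{\varepsilon}{\tau}\Big)^{1/2}\int_{\mathbb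 R^n} f,\qquad \int_{\mathbb R^n}|g-a^{-\lambda}\tilde h|\le C_n\Big(\frac{\varepsilon}{\tau}\Big)^{1/2}\int_{\mathbb R^n} g,\qquad \int_{\mathbb R^n}|h-\tilde h|\le C_n\Big(\frac{\varepsilon}{\tau}\Big)^{1/2}\int_{\mathbb R^n} h .$$ (Sharpness of the order.) There are $c_n,\varepsilon_n>0$ depending only on $n$ such that for all $\lambda\in(0,1)$ and $0<\varepsilon\le\varepsilon_n\tau$ there exist radial, integrable, log-concave $h,f,g:\mathbb R^n\to[0,\infty)$ with $\int f>0$, $\int g>0$ that satisfy both displayed hypotheses above, and such that for every $a>0$ and every radial, integrable, log-concave $\tilde h$, $$\int_{\mathbb R^n}|f-a^{1-\lambda}\tilde h|\ge c_n\Big(\frac{\varepsilon}{\tau}\Big)^{1/2}\int_{\mathbb R^n} f\qquad\text{or}\qquad \int_{\mathbb R^n}|g-a^{-\lambda}\tilde h|\ge c_n\Big(\frac{\varepsilon}{\tau}\Big)^{1/2}\int_{\mathbb R^n} g .$$ -/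

import Mathlib

open MeasureTheory

/-- `φ : ℝⁿ → ℝ` is radial: its value depends only on the Euclidean norm of the point. -/
def IsRadial {n : ℕ} (φ : EuclideanSpace ℝ (Fin n) → ℝ) : Prop :=
  ∀ x y : EuclideanSpace ℝ (Fin n), ‖x‖ = ‖y‖ → φ x = φ y

/-- `φ : ℝⁿ → ℝ₊` is log-concave:
`φ (t x + (1 - t) y) ≥ φ(x) ^ t φ(y) ^ (1 - t)` for all `x, y` and all `t ∈ (0, 1)`. -/
def IsLogConcave {n : ℕ} (φ : EuclideanSpace ℝ (Fin n) → ℝ) : Prop :=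
  (∀ x, 0 ≤ φ x) ∧
    ∀ x y : EuclideanSpace ℝ (Fin n), ∀ t : ℝ, 0 < t → t < 1 →
      φ x ^ t * φ y ^ (1 - t) ≤ φ (t • x + (1 - t) • y)

/-- The pointwise hypothesis of the Prékopa–Leindler inequality with parameter `lam`. -/
def PLCondition {n : ℕ} (lam : ℝ) (h f g : EuclideanSpace ℝ (Fin n) → ℝ) : Prop :=
  ∀ x y : EuclideanSpace ℝ (Fin n),
    f x ^ lam * g y ^ (1 - lam) ≤ h (lam • x + (1 - lam) • y)

/-- Equality up to a factor `1 + ε` in the Prékopa–Leindler inequality. -/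
def PLAlmostEq {n : ℕ} (lam ε : ℝ) (h f g : EuclideanSpace ℝ (Fin n) → ℝ) : Prop :=
  ∫ x, h x ≤ (1 + ε) * ((∫ x, f x) ^ lam * (∫ x, g x) ^ (1 - lam))

/-! In polar coordinates everything becomes a statement about profiles `F`, `G`, `H` on the
half-line with weight `r ^ m`, `m = n - 1`. A radial log-concave function has a non-increasing
profile, and this monotonicity is what makes the argument work.

Normalise the masses of `F` and `G` to one, let `q` and `p` be the quantile functions of `r ^ m F`
and `r ^ m G`, and put `z = l q + (1 - l) p`. By symmetry `l ≥ 1/2`, so `τ = 1 - l`. Changing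
variables along `z` gives `∫ N ≤ ∫ r ^ m H` for `N = z' z ^ m H(z)`, and the pointwise hypothesis
bounds `N` below by a product of arithmetic-geometric mean ratios of `x = p / q` (`m` times) and `y
= p' / q'` (once). Hence `N ≥ 1`, which is the inequality itself. Near equality the total of `d = (N
- 1) / (1 - l)` is at most `θ ^ 2`, where `θ` is essentially `(ε / τ) ^ (1/2)`. Quadratic stability
of the mean inequality shows that the relevant quotients of volume elements are within `C √d` of one
(with an extra term linear in `d` where they may be large), and `√d ≤ θ + d / θ` integrates to at
most `2 θ`. This is the source of the exponent `1/2`.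

It remains to pass from `H(z)` to `H(q)` and `H(p)`, since `∫ r ^ m (F - H)₊ = ∫ (1 - H(q) /
F(q))₊`, and likewise for `G`. Where `z` lies on the favourable side, monotonicity of `H` suffices.
On the unfavourable set one compares integrals instead of values: the image of that set under one
map is contained in its image under the other, so the difference of the two integrals has a sign.
For `G` an exceptional set `p > 2 q` must be cut out, and there `d` is bounded below. These steps
are `transport_pointwise` and `transport_stability_aux`.

The transport argument needs regular `F`, `G` and non-increasing `H`. If `h` is log-concave, `F` and
`G` are enlarged to the maximal functions the hypothesis permits; these are log-concave and, by the
inequality itself, have barely more mass. If `f` and `g` are log-concave, `H` is shrunk to the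
minimal non-increasing admissible function.

For sharpness take indicators of balls of radii `1` and `1 + η` with `η` of order `(ε / τ) ^ (1/2)`.
Closeness of both to multiples of one function would make them nearly proportional to each other. -/

/-! ### Stability of the weighted arithmetic-geometric mean inequality in one variable -/

/-- The weighted arithmetic mean of `1` and `x` over their weighted geometric mean. -/
noncomputable def amgmRatio (l x : ℝ) : ℝ := (l + (1 - l) * x) / x ^ (1 - l)

/-- The ratio equals `l exp(-(1 - l) log x) + (1 - l) x ^ l`; only the first exponential is replaced
by its tangent. Keeping `x ^ l` leaves a deficit with the factor `1 - l` and a remainder usable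
uniformly for `l ≥ 1/2`. -/
lemma one_add_mul_le_amgmRatio {l x : ℝ} (h0 : 0 ≤ l) (hx : 0 < x) :
    1 + (1 - l) * (x ^ l - 1 - l * Real.log x) ≤ amgmRatio l x := by
  have h1 : amgmRatio l x = l * Real.exp (-((1 - l) * Real.log x)) + (1 - l) * x ^ l := by
    unfold amgmRatio
    have hx1 : x ^ l = x / x ^ (1 - l) := by
      rw [show l = 1 - (1 - l) by ring, Real.rpow_sub hx, Real.rpow_one]; ring_nf
    rw [hx1, Real.rpow_def_of_pos hx, Real.exp_neg]
    rw [mul_comm (Real.log x)]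
    field_simp
  have h2 := Real.add_one_le_exp (-((1 - l) * Real.log x))
  rw [h1]
  nlinarith [mul_le_mul_of_nonneg_left h2 h0]

lemma log_rpow_excess_nonneg {l x : ℝ} (hx : 0 < x) : 0 ≤ x ^ l - 1 - l * Real.log x := by
  have h := Real.log_le_sub_one_of_pos (Real.rpow_pos_of_pos hx l)
  rw [Real.log_rpow hx] at h; linarith

lemma one_le_amgmRatio {l x : ℝ} (h0 : 0 ≤ l) (h1 : l ≤ 1) (hx : 0 < x) :
    1 ≤ amgmRatio l x := by
  have := one_add_mul_le_amgmRatio h0 hx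
  nlinarith [log_rpow_excess_nonneg (l := l) hx]

section OneVariable

variable {l x s : ℝ}

lemma one_sub_le_of_excess_le (hl : 1 / 2 ≤ l) (hx : 0 < x) (hx1 : x ≤ 1) (hs : 0 ≤ s)
    (h : x ^ l - 1 - l * Real.log x ≤ s ^ 2) : 1 - x ≤ 4 * s := by
  -- In terms of `q` the excess is `q ^ 2 - 1 - 2 log q ≥ (1 - q) ^ 2`; Bernoulli's inequality for
  -- `q ^ 4 ≤ x` then returns to `x`.
  set q := x ^ (l / 2) with hq
  have hq0 : 0 < q := Real.rpow_pos_of_pos hx _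
  have hq2 : x ^ l = q ^ 2 := by
    rw [hq, ← Real.rpow_natCast, ← Real.rpow_mul hx.le]; congr 1; push_cast; ring
  have hlog : l * Real.log x = 2 * Real.log q := by
    rw [hq, Real.log_rpow hx]; ring
  have h1 := Real.log_le_sub_one_of_pos hq0
  have hqle : q ≤ 1 := Real.rpow_le_one hx.le hx1 (by linarith)
  have h2 : (1 - q) ^ 2 ≤ s ^ 2 := by rw [hq2, hlog] at h; nlinarith
  have h3 : 1 - q ≤ s := by nlinarith [abs_le_of_sq_le_sq h2 hs]
  have h4 : q ^ 4 ≤ x := by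
    rw [show q ^ 4 = x ^ (2 * l) by
      rw [hq, ← Real.rpow_natCast, ← Real.rpow_mul hx.le]; congr 1; push_cast; ring]
    calc x ^ (2 * l) ≤ x ^ (1 : ℝ) := Real.rpow_le_rpow_of_exponent_ge hx hx1 (by linarith)
      _ = x := Real.rpow_one x
  nlinarith [one_add_mul_le_pow (show (-2 : ℝ) ≤ q - 1 by linarith) 4, show (1 + (q - 1)) = q by ring]

lemma log_le_of_excess_le (hl : 1 / 2 ≤ l) (hx1 : 1 ≤ x) (hs : 0 ≤ s)
    (h : x ^ l - 1 - l * Real.log x ≤ s ^ 2) : Real.log x ≤ 3 * s := by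
  have hx : 0 < x := by linarith
  have hlog := Real.log_nonneg hx1
  have h1 := Real.quadratic_le_exp_of_nonneg (mul_nonneg (by linarith : 0 ≤ l) hlog)
  rw [show x ^ l = Real.exp (l * Real.log x) by rw [Real.rpow_def_of_pos hx, mul_comm]] at h
  have h2 : (l * Real.log x) ^ 2 ≤ 2 * s ^ 2 := by linarith
  have h3 : l * Real.log x ≤ 3 / 2 * s := by
    apply le_of_sq_le_sq _ (by positivity)
    nlinarith
  nlinarith

lemma one_sub_inv_le_of_excess_le (hl : 1 / 2 ≤ l) (hx1 : 1 ≤ x) (hs : 0 ≤ s)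
    (h : x ^ l - 1 - l * Real.log x ≤ s ^ 2) : x - 1 ≤ 3 * s * x := by
  have hx : 0 < x := by linarith
  have h1 := log_le_of_excess_le hl hx1 hs h
  have h2 := Real.one_sub_inv_le_log_of_pos hx
  have h3 : 1 - x⁻¹ ≤ 3 * s := h2.trans h1
  have h4 := mul_le_mul_of_nonneg_right h3 hx.le
  rwa [sub_mul, one_mul, inv_mul_cancel₀ hx.ne'] at h4

lemma abs_one_sub_inv_affine_le (hl : 1 / 2 ≤ l) (hl1 : l < 1) (hx : 0 < x) (hs : 0 ≤ s)
    (h : x ^ l - 1 - l * Real.log x ≤ s ^ 2) : |1 - 1 / (l + (1 - l) * x)| ≤ 4 * s := by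
  have hp : 0 < l + (1 - l) * x := by nlinarith
  rw [show 1 - 1 / (l + (1 - l) * x) = (1 - l) * (x - 1) / (l + (1 - l) * x) by
    field_simp; ring]
  rw [abs_le, le_div_iff₀ hp, div_le_iff₀ hp]
  rcases le_total x 1 with h1 | h1
  · have := one_sub_le_of_excess_le hl hx h1 hs h
    constructor <;> nlinarith [mul_nonneg hs hx.le, mul_nonneg (mul_nonneg hs hx.le) (by linarith : 0 ≤ 1 - l),
      mul_nonneg hs (by linarith : 0 ≤ l - 1/2)]
  · have := one_sub_inv_le_of_excess_le hl h1 hs h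
    constructor
    · nlinarith [mul_nonneg hs hp.le, mul_nonneg (by linarith : 0 ≤ x - 1) (by linarith : 0 ≤ 1 - l)]
    · nlinarith [mul_nonneg (by linarith : 0 ≤ 1 - l) (sub_nonneg.2 this), mul_nonneg hs hp.le,
        mul_nonneg hs (by linarith : 0 ≤ l)]

lemma one_sub_div_affine_le (hl : 1 / 2 ≤ l) (hl1 : l < 1) (hx : 0 < x) (hs : 0 ≤ s)
    (h : x ^ l - 1 - l * Real.log x ≤ s ^ 2) : 1 - x / (l + (1 - l) * x) ≤ 4 * s := by
  have hp : 0 < l + (1 - l) * x := by nlinarith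
  rw [show 1 - x / (l + (1 - l) * x) = l * (1 - x) / (l + (1 - l) * x) by
    rw [eq_div_iff hp.ne', sub_mul, div_mul_cancel₀ _ hp.ne']; ring, div_le_iff₀ hp]
  rcases le_total x 1 with h1 | h1
  · have := one_sub_le_of_excess_le hl hx h1 hs h
    nlinarith [mul_nonneg hs hx.le, mul_nonneg (mul_nonneg hs hx.le) (by linarith : 0 ≤ 1 - l)]
  · nlinarith [mul_nonneg hs hp.le, mul_nonneg (by linarith : 0 ≤ x - 1) (by linarith : 0 ≤ l)]

/-- The term `s ^ 2` is unavoidable uniformly in `l`: as `l` tends to one and `x` is large, the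
quotient behaves like `x`, and so does the excess. -/
lemma div_affine_sub_one_le (hl : 1 / 2 ≤ l) (hl1 : l < 1) (hx : 0 < x) (hs : 0 ≤ s)
    (h : x ^ l - 1 - l * Real.log x ≤ s ^ 2) :
    x / (l + (1 - l) * x) - 1 ≤ 12 * (s + s ^ 2) := by
  have hp : 0 < l + (1 - l) * x := by nlinarith
  rcases le_total x 4 with h4 | h4
  · rw [show x / (l + (1 - l) * x) - 1 = l * (x - 1) / (l + (1 - l) * x) by
      rw [eq_div_iff hp.ne', sub_mul, div_mul_cancel₀ _ hp.ne']; ring, div_le_iff₀ hp]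
    rcases le_total x 1 with h1 | h1
    · have : 0 ≤ 12 * (s + s ^ 2) * (l + (1 - l) * x) := by positivity
      nlinarith [mul_nonneg (by linarith : 0 ≤ 1 - x) (by linarith : 0 ≤ l)]
    · have h5 := one_sub_inv_le_of_excess_le hl h1 hs h
      have h6 : 3 * s * x ≤ 12 * s := by nlinarith
      have h7 : 1 ≤ l + (1 - l) * x := by nlinarith
      calc l * (x - 1) ≤ 1 * (x - 1) := by gcongr
        _ ≤ 12 * (s + s ^ 2) * 1 := by nlinarith [sq_nonneg s]
        _ ≤ _ := by gcongr
  · have hq : 2 ≤ x ^ l := by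
      calc (2 : ℝ) = 4 ^ (1 / 2 : ℝ) := by
            rw [← Real.sqrt_eq_rpow, show (4 : ℝ) = 2 ^ 2 by norm_num,
              Real.sqrt_sq (by norm_num)]
        _ ≤ 4 ^ l := Real.rpow_le_rpow_of_exponent_le (by norm_num) hl
        _ ≤ x ^ l := Real.rpow_le_rpow (by norm_num) h4 (by linarith)
    -- For large `x` the mean inequality bounds the quotient by `x ^ l`, which the excess itself
    -- controls linearly.
    have h1 : x / (l + (1 - l) * x) ≤ x ^ l := by
      have h2 := one_le_amgmRatio (l := l) (by linarith) hl1.le hx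
      unfold amgmRatio at h2
      have hxp := Real.rpow_pos_of_pos hx (1 - l)
      rw [one_le_div hxp] at h2
      rw [div_le_iff₀ hp]
      calc x = x ^ l * x ^ (1 - l) := by
            rw [← Real.rpow_add hx]; simp
        _ ≤ _ := by gcongr
    set q := x ^ l with hqd
    have hlog : l * Real.log x = Real.log q := by rw [hqd, Real.log_rpow hx]
    have h3 := Real.log_le_sub_one_of_pos (show 0 < q / 2 by linarith)
    rw [Real.log_div (by linarith) (by norm_num)] at h3
    have h4 := Real.log_two_lt_d9
    nlinarith

lemma one_le_of_excess_le (hl : 1 / 2 ≤ l) (hx : 2 ≤ x) (hs : 0 ≤ s)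
    (h : x ^ l - 1 - l * Real.log x ≤ s ^ 2) : 1 ≤ 25 * s ^ 2 := by
  have h1 := log_le_of_excess_le hl (by linarith) hs h
  have h2 := Real.log_le_log (by norm_num) hx
  have h3 := Real.log_two_gt_d9
  nlinarith

end OneVariable

/-! ### Quotients of radial volume elements -/

lemma abs_one_sub_pow_le (m : ℕ) {a : ℝ} (h0 : 0 ≤ a) (h2 : a ≤ 2) :
    |1 - a ^ m| ≤ m * 2 ^ m * |1 - a| := by
  induction m with
  | zero => simp
  | succ m ih =>
    have h : 1 - a ^ (m + 1) = (1 - a) + a * (1 - a ^ m) := by ring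
    calc |1 - a ^ (m + 1)| ≤ |1 - a| + |a * (1 - a ^ m)| := by rw [h]; exact abs_add_le _ _
      _ ≤ 2 ^ (m + 1) * |1 - a| + 2 * (m * 2 ^ m * |1 - a|) := by
          rw [abs_mul, abs_of_nonneg h0]
          gcongr
          exact le_mul_of_one_le_left (abs_nonneg _) (one_le_pow₀ (by norm_num))
      _ = _ := by push_cast; ring

section Jacobian

variable {m : ℕ} {l x y N θ : ℝ}

/-- The ratio of the radial volume elements at `l r + (1 - l) s` and at `r`, where `x = s / r` and
`y = s' / r'`. -/
noncomputable def jacobianRatio (m : ℕ) (l x y : ℝ) : ℝ :=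
  (l + (1 - l) * x) ^ m * (l + (1 - l) * y)

lemma jacobianRatio_pos (hl : 1 / 2 ≤ l) (hl1 : l < 1) (hx : 0 < x) (hy : 0 < y) :
    0 < jacobianRatio m l x y := by
  have : 0 < l + (1 - l) * x := by nlinarith
  have : 0 < l + (1 - l) * y := by nlinarith
  unfold jacobianRatio; positivity

/-- Every factor of the product is at least one, so each single factor is at most `N`; the same
applies to `x` when `m ≠ 0`. -/
lemma excess_right_le (hl : 1 / 2 ≤ l) (hl1 : l < 1) (hx : 0 < x) (hy : 0 < y)
    (hN : amgmRatio l x ^ m * amgmRatio l y ≤ N) :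
    y ^ l - 1 - l * Real.log y ≤ (N - 1) / (1 - l) := by
  rw [le_div_iff₀ (by linarith)]
  have h1 := one_add_mul_le_amgmRatio (l := l) (by linarith) hy
  have h2 := one_le_pow₀ (n := m) (one_le_amgmRatio (l := l) (by linarith) hl1.le hx)
  have h3 := one_le_amgmRatio (l := l) (by linarith) hl1.le hy
  nlinarith

lemma excess_left_le (hl : 1 / 2 ≤ l) (hl1 : l < 1) (hx : 0 < x) (hy : 0 < y) (hm : m ≠ 0)
    (hN : amgmRatio l x ^ m * amgmRatio l y ≤ N) :
    x ^ l - 1 - l * Real.log x ≤ (N - 1) / (1 - l) := by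
  rw [le_div_iff₀ (by linarith)]
  have h1 := one_add_mul_le_amgmRatio (l := l) (by linarith) hx
  have h2 := one_le_amgmRatio (l := l) (by linarith) hl1.le hx
  have h4 : amgmRatio l x ≤ amgmRatio l x ^ m := le_self_pow₀ h2 hm
  have h3 := one_le_amgmRatio (l := l) (by linarith) hl1.le hy
  nlinarith

lemma one_le_of_amgm_le (hl : 1 / 2 ≤ l) (hl1 : l < 1) (hx : 0 < x) (hy : 0 < y)
    (hN : amgmRatio l x ^ m * amgmRatio l y ≤ N) : 1 ≤ N := by
  have h2 := one_le_pow₀ (n := m) (one_le_amgmRatio (l := l) (by linarith) hl1.le hx)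
  have h3 := one_le_amgmRatio (l := l) (by linarith) hl1.le hy
  nlinarith

/-- Linearises the square root, so that a bound on the integral of `d` alone yields a bound of order
`θ`. -/
lemma sqrt_le_add_div {d : ℝ} (hd : 0 ≤ d) (hθ : 0 < θ) : √d ≤ θ + d / θ := by
  have h : d / θ * θ = d := div_mul_cancel₀ _ hθ.ne'
  have h1 : 0 ≤ d / θ := by positivity
  apply Real.sqrt_le_iff.2 ⟨by positivity, _⟩
  nlinarith [sq_nonneg θ, sq_nonneg (d / θ)]

lemma le_div_self_of_le_one {d : ℝ} (hd : 0 ≤ d) (hθ : 0 < θ) (hθ1 : θ ≤ 1) : d ≤ d / θ := by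
  rw [le_div_iff₀ hθ]; nlinarith

lemma inv_affine_le_two (hl : 1 / 2 ≤ l) (hl1 : l < 1) (hx : 0 < x) :
    1 / (l + (1 - l) * x) ≤ 2 := by
  rw [div_le_iff₀ (by nlinarith)]; nlinarith

lemma mul_abs_one_sub_inv_jacobianRatio_le (hl : 1 / 2 ≤ l) (hl1 : l < 1) (hx : 0 < x) (hy : 0 < y)
    (hθ : 0 < θ) (hθ1 : θ ≤ 1) (hN : amgmRatio l x ^ m * amgmRatio l y ≤ N) :
    N * |1 - 1 / jacobianRatio m l x y| ≤
      (9 + 9 * m) * 2 ^ m * (θ + (N - 1) / (1 - l) / θ) := by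
  have hN1 := one_le_of_amgm_le hl hl1 hx hy hN
  have hd : 0 ≤ (N - 1) / (1 - l) := div_nonneg (by linarith) (by linarith)
  set d := (N - 1) / (1 - l) with hdd
  have hNd : N = 1 + (1 - l) * d := by 
    have h1 : 1 - l ≠ 0 := by linarith
    rw [hdd]; field_simp; ring
  have hsq : √d ^ 2 = d := Real.sq_sqrt hd
  have hs := sqrt_le_add_div hd hθ
  have hdle := le_div_self_of_le_one hd hθ hθ1
  have hey := excess_right_le hl hl1 hx hy hN
  have hy4 := abs_one_sub_inv_affine_le hl hl1 hy (Real.sqrt_nonneg d) (hey.trans hsq.ge)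
  have hpx : 0 < l + (1 - l) * x := by nlinarith
  have hpy : 0 < l + (1 - l) * y := by nlinarith
  have hax := inv_affine_le_two hl hl1 hx
  have hby := inv_affine_le_two hl hl1 hy
  set a := 1 / (l + (1 - l) * x) with ha
  set b := 1 / (l + (1 - l) * y) with hb
  have ha0 : 0 < a := by positivity
  have hb0 : 0 < b := by positivity
  have hw : 1 / jacobianRatio m l x y = a ^ m * b := by
    rw [ha, hb, jacobianRatio, one_div_pow, one_div_mul_one_div]
  have ham : |1 - a ^ m| ≤ m * 2 ^ m * (4 * √d) := by
    rcases eq_or_ne m 0 with rfl | hm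
    · simp
    · refine (abs_one_sub_pow_le m ha0.le hax).trans ?_
      have := abs_one_sub_inv_affine_le hl hl1 hx (Real.sqrt_nonneg d)
        ((excess_left_le hl hl1 hx hy hm hN).trans hsq.ge)
      gcongr
  have h2m : (1 : ℝ) ≤ 2 ^ m := one_le_pow₀ (by norm_num)
  have hsmall : |1 - 1 / jacobianRatio m l x y| ≤ (4 + 8 * m) * 2 ^ m * √d := by
    rw [hw]
    calc |1 - a ^ m * b| = |(1 - b) + b * (1 - a ^ m)| := by ring_nf
      _ ≤ |1 - b| + |b * (1 - a ^ m)| := abs_add_le _ _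
      _ ≤ 4 * √d + 2 * (m * 2 ^ m * (4 * √d)) := by
          rw [abs_mul, abs_of_pos hb0]; gcongr
      _ ≤ 2 ^ m * (4 * √d) + 2 * (m * 2 ^ m * (4 * √d)) := by
          have := le_mul_of_one_le_left (by positivity : 0 ≤ 4 * √d) h2m
          linarith
      _ = _ := by ring
  have hbig : |1 - 1 / jacobianRatio m l x y| ≤ 2 * 2 ^ m := by
    have h1 : a ^ m * b ≤ 2 ^ m * 2 := by gcongr
    have h3 : 0 < a ^ m * b := by positivity
    rw [hw, abs_le]; constructor <;> linarith
  -- Write `N = 1 + (1 - l) d`: the summand one uses the bound of order `√d`, and the summand in `d`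
  -- only the boundedness.
  calc N * |1 - 1 / jacobianRatio m l x y|
      = |1 - 1 / jacobianRatio m l x y| + (1 - l) * d * |1 - 1 / jacobianRatio m l x y| := by
        rw [hNd]; ring
    _ ≤ (4 + 8 * m) * 2 ^ m * √d + 1 * d * (2 * 2 ^ m) := by
        gcongr; linarith
    _ ≤ (4 + 8 * m) * 2 ^ m * (θ + d / θ) + 1 * (θ + d / θ) * (2 * 2 ^ m) := by
        gcongr; linarith
    _ ≤ _ := by
        have : 0 ≤ 2 ^ m * (θ + d / θ) := by positivity
        nlinarith [mul_nonneg (Nat.cast_nonneg (α := ℝ) m) this]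

lemma one_sub_jacobian_quotient_le (hl : 1 / 2 ≤ l) (hl1 : l < 1) (hx : 0 < x) (hy : 0 < y)
    (hθ : 0 < θ) (hx1 : x ≤ 1) (hN : amgmRatio l x ^ m * amgmRatio l y ≤ N) :
    1 - x ^ m * y / jacobianRatio m l x y ≤
      (4 + 4 * m) * 2 ^ m * (θ + (N - 1) / (1 - l) / θ) := by
  have hN1 := one_le_of_amgm_le hl hl1 hx hy hN
  have hd : 0 ≤ (N - 1) / (1 - l) := div_nonneg (by linarith) (by linarith)
  set d := (N - 1) / (1 - l) with hdd
  have hsq : √d ^ 2 = d := Real.sq_sqrt hd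
  have hs := sqrt_le_add_div hd hθ
  have hey := excess_right_le hl hl1 hx hy hN
  have hy4 := one_sub_div_affine_le hl hl1 hy (Real.sqrt_nonneg d) (hey.trans hsq.ge)
  have hpx : 0 < l + (1 - l) * x := by nlinarith
  have hpy : 0 < l + (1 - l) * y := by nlinarith
  have hp1 : x / (l + (1 - l) * x) ≤ 1 := by rw [div_le_one hpx]; nlinarith
  set p := x / (l + (1 - l) * x) with hp
  set q := y / (l + (1 - l) * y) with hq
  have hp0 : 0 < p := by positivity
  have hw : x ^ m * y / jacobianRatio m l x y = p ^ m * q := by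
    rw [hp, hq, jacobianRatio, div_pow, div_mul_div_comm]
  have hpm : 1 - p ^ m ≤ m * 2 ^ m * (4 * √d) := by
    rcases eq_or_ne m 0 with rfl | hm
    · simp
    · refine (le_abs_self _).trans ((abs_one_sub_pow_le m hp0.le (by linarith)).trans ?_)
      have := one_sub_div_affine_le hl hl1 hx (Real.sqrt_nonneg d)
        ((excess_left_le hl hl1 hx hy hm hN).trans hsq.ge)
      rw [abs_of_nonneg (by linarith)]
      gcongr
  have h2m : (1 : ℝ) ≤ 2 ^ m := one_le_pow₀ (by norm_num)
  have hpm1 : p ^ m ≤ 1 := pow_le_one₀ hp0.le hp1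
  rw [hw]
  calc 1 - p ^ m * q = (1 - p ^ m) + p ^ m * (1 - q) := by ring
    _ ≤ m * 2 ^ m * (4 * √d) + 1 * (4 * √d) := by
        have : p ^ m * (1 - q) ≤ p ^ m * (4 * √d) := by gcongr
        have : p ^ m * (4 * √d) ≤ 1 * (4 * √d) := by gcongr
        linarith
    _ ≤ m * 2 ^ m * (4 * √d) + 2 ^ m * (4 * √d) := by gcongr
    _ = (4 + 4 * m) * 2 ^ m * √d := by ring
    _ ≤ _ := by gcongr

lemma one_le_excess_of_two_le (hl : 1 / 2 ≤ l) (hl1 : l < 1) (hy : 0 < y) (hm : m ≠ 0)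
    (hx2 : 2 ≤ x) (hN : amgmRatio l x ^ m * amgmRatio l y ≤ N) :
    1 ≤ 25 * ((N - 1) / (1 - l)) := by
  have hx : 0 < x := by linarith
  have hN1 := one_le_of_amgm_le hl hl1 hx hy hN
  have hd : 0 ≤ (N - 1) / (1 - l) := div_nonneg (by linarith) (by linarith)
  have h := one_le_of_excess_le hl hx2 (Real.sqrt_nonneg _)
    ((excess_left_le hl hl1 hx hy hm hN).trans (Real.sq_sqrt hd).ge)
  rwa [Real.sq_sqrt hd] at h

/-- For `m > 0` the cutoff `x ≤ 2` keeps the `m`-th power of `x / (l + (1 - l) x)` below `2 ^ m`.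
The last factor needs no cutoff, because its product with `1 - l` is at most one, which absorbs the
factor `N`. -/
lemma mul_jacobian_quotient_sub_one_le (hl : 1 / 2 ≤ l) (hl1 : l < 1) (hx : 0 < x) (hy : 0 < y)
    (hθ : 0 < θ) (hθ1 : θ ≤ 1) (hx1 : 1 ≤ x) (hx2 : m = 0 ∨ x ≤ 2)
    (hN : amgmRatio l x ^ m * amgmRatio l y ≤ N) :
    N * (x ^ m * y / jacobianRatio m l x y) - 1 ≤
      (25 + 24 * m) * 2 ^ m * (θ + (N - 1) / (1 - l) / θ) := by
  have hN1 := one_le_of_amgm_le hl hl1 hx hy hN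
  have hd : 0 ≤ (N - 1) / (1 - l) := div_nonneg (by linarith) (by linarith)
  set d := (N - 1) / (1 - l) with hdd
  have hNd : N = 1 + (1 - l) * d := by 
    have h1 : 1 - l ≠ 0 := by linarith
    rw [hdd]; field_simp; ring
  have hsq : √d ^ 2 = d := Real.sq_sqrt hd
  have hs := sqrt_le_add_div hd hθ
  have hdle := le_div_self_of_le_one hd hθ hθ1
  have hey := excess_right_le hl hl1 hx hy hN
  have hy4 := div_affine_sub_one_le hl hl1 hy (Real.sqrt_nonneg d) (hey.trans hsq.ge)
  rw [hsq] at hy4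
  have hpx : 0 < l + (1 - l) * x := by nlinarith
  have hpy : 0 < l + (1 - l) * y := by nlinarith
  have hp1 : 1 ≤ x / (l + (1 - l) * x) := by rw [one_le_div hpx]; nlinarith
  have hpx1 : 1 ≤ l + (1 - l) * x := by nlinarith
  have hql : (1 - l) * (y / (l + (1 - l) * y)) ≤ 1 := by
    rw [← mul_div_assoc, div_le_one hpy]; linarith
  set p := x / (l + (1 - l) * x) with hp
  set q := y / (l + (1 - l) * y) with hq
  have hp0 : 0 < p := by positivity
  have hq0 : 0 < q := by positivity
  have hw : x ^ m * y / jacobianRatio m l x y = p ^ m * q := by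
    rw [hp, hq, jacobianRatio, div_pow, div_mul_div_comm]
  have hp2 : m = 0 ∨ p ≤ 2 := hx2.imp id fun h => by
    rw [hp, div_le_iff₀ hpx]; linarith
  have hpm2 : p ^ m ≤ 2 ^ m := by
    rcases hp2 with rfl | h
    · simp
    · gcongr
  have hpm : p ^ m - 1 ≤ m * 2 ^ m * (12 * (√d + d)) := by
    rcases eq_or_ne m 0 with rfl | hm
    · simp
    · have h2 : p ≤ 2 := hp2.resolve_left hm
      refine (le_abs_self _).trans ((abs_sub_comm _ _).le.trans
        ((abs_one_sub_pow_le m hp0.le h2).trans ?_))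
      have := div_affine_sub_one_le hl hl1 hx (Real.sqrt_nonneg d)
        ((excess_left_le hl hl1 hx hy hm hN).trans hsq.ge)
      rw [hsq] at this
      rw [abs_sub_comm, abs_of_nonneg (by linarith)]
      gcongr
  have h2m : (1 : ℝ) ≤ 2 ^ m := one_le_pow₀ (by norm_num)
  have hE : √d + d ≤ 2 * (θ + d / θ) - θ := by linarith
  have hu : p ^ m * q - 1 ≤ (12 + 12 * m) * 2 ^ m * (√d + d) := by
    calc p ^ m * q - 1 = p ^ m * (q - 1) + (p ^ m - 1) := by ring
      _ ≤ p ^ m * (12 * (√d + d)) + m * 2 ^ m * (12 * (√d + d)) := by gcongr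
      _ ≤ 2 ^ m * (12 * (√d + d)) + m * 2 ^ m * (12 * (√d + d)) := by gcongr
      _ = _ := by ring
  rw [hw]
  calc N * (p ^ m * q) - 1 = d * (p ^ m * ((1 - l) * q)) + (p ^ m * q - 1) := by
        rw [hNd]; ring
    _ ≤ d * (2 ^ m * 1) + (12 + 12 * m) * 2 ^ m * (√d + d) := by gcongr
    _ ≤ (θ + d / θ) * (2 ^ m * 1) + (12 + 12 * m) * 2 ^ m * (2 * (θ + d / θ)) := by
        gcongr <;> linarith
    _ = _ := by ring

end Jacobian

/-! ### Quantile functions -/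

open Set Filter Topology in
/-- The quantile function of a density that is positive and continuous on an open interval
starting at `0`. -/
lemma exists_quantile {P : ℝ → ℝ} {U : Set ℝ} (hU : IsOpen U) (hU0 : U ⊆ Ioi 0)
    (hlow : ∀ r ∈ U, ∀ s, 0 < s → s ≤ r → s ∈ U) (hc : ContinuousOn P U)
    (hpos : ∀ r ∈ U, 0 < P r) (hint : IntegrableOn P U) (h1 : ∫ r in U, P r = 1) :
    ∃ q : ℝ → ℝ, StrictMonoOn q (Ioo 0 1) ∧ q '' Ioo 0 1 = U ∧
      ∀ t ∈ Ioo (0 : ℝ) 1, HasDerivAt q (P (q t))⁻¹ t := by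
  have hint0 : Integrable (U.indicator P) := (integrable_indicator_iff hU.measurableSet).2 hint
  have hnn : ∀ r, 0 ≤ U.indicator P r := fun r => indicator_nonneg (fun r hr => (hpos r hr).le) r
  set Φ : ℝ → ℝ := fun r => ∫ x in (0 : ℝ)..r, U.indicator P x with hΦ
  have hΦc : Continuous Φ := intervalIntegral.continuous_primitive
    (fun a b => hint0.intervalIntegrable) 0
  have hΦd : ∀ r ∈ U, HasDerivAt Φ (P r) r := fun r hr => by
    have hev : U.indicator P =ᶠ[𝓝 r] P := by
      filter_upwards [hU.mem_nhds hr] with x hx using indicator_of_mem hx P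
    have h := intervalIntegral.integral_hasDerivAt_right (a := 0) (b := r)
      hint0.intervalIntegrable
      (hint0.aestronglyMeasurable.stronglyMeasurableAtFilter)
      (((hc.continuousAt (hU.mem_nhds hr))).congr hev.symm)
    rwa [indicator_of_mem hr] at h
  have hΦ0 : Φ 0 = 0 := by simp [hΦ]
  have hval : ∀ r, 0 ≤ r → Φ r = ∫ x in Ioc 0 r ∩ U, P x := fun r hr => by
    simp only [hΦ, intervalIntegral.integral_of_le hr]
    rw [setIntegral_indicator hU.measurableSet]
  have hnonneg : ∀ r, 0 ≤ r → 0 ≤ Φ r := fun r hr =>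
    intervalIntegral.integral_nonneg hr fun x _ => hnn x
  have hle : ∀ r, 0 ≤ r → Φ r ≤ 1 := fun r hr => by
    rw [hval r hr, ← h1]
    refine setIntegral_mono_set hint ?_ (Eventually.of_forall inter_subset_right)
    exact (ae_restrict_iff' hU.measurableSet).2 (Eventually.of_forall fun x hx => (hpos x hx).le)
  have hconv : Convex ℝ U := by
    refine (ordConnected_iff.2 fun x hx y hy _ z hz => ?_).convex
    exact hlow y hy z ((hU0 hx).trans_le hz.1) hz.2
  have hmono : StrictMonoOn Φ U := by
    refine strictMonoOn_of_deriv_pos hconv hΦc.continuousOn fun x hx => ?_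
    rw [hU.interior_eq] at hx
    rw [(hΦd x hx).deriv]; exact hpos x hx
  have hmem : ∀ r ∈ U, Φ r ∈ Ioo (0 : ℝ) 1 := fun r hr => by
    have hr0 : 0 < r := hU0 hr
    constructor
    · have h2 : r / 2 ∈ U := hlow r hr _ (by linarith) (by linarith)
      exact (hnonneg (r / 2) (by linarith)).trans_lt (hmono h2 hr (by linarith))
    · obtain ⟨u, hu, huU⟩ : ∃ u, r < u ∧ u ∈ U :=
        ((eventually_mem_nhdsWithin (s := Ioi r) (a := r)).and
          (mem_nhdsWithin_of_mem_nhds (hU.mem_nhds hr))).exists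
      exact (hmono hr huU hu).trans_le (hle u (hr0.trans hu).le)
  have hlim : Tendsto Φ atTop (𝓝 1) := by
    have h := intervalIntegral_tendsto_integral_Ioi (f := U.indicator P) 0
      hint0.integrableOn tendsto_id
    rwa [setIntegral_indicator hU.measurableSet, inter_eq_right.2 hU0, h1] at h
  have hex : ∀ t ∈ Ioo (0 : ℝ) 1, ∃ r ∈ U, Φ r = t := fun t ht => by
    obtain ⟨R, hR, hR0⟩ := ((hlim.eventually (lt_mem_nhds ht.2)).and (eventually_ge_atTop 0)).exists
    obtain ⟨r, hr, hrt⟩ := intermediate_value_Icc hR0 hΦc.continuousOn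
      (show t ∈ Icc (Φ 0) (Φ R) from ⟨by rw [hΦ0]; exact ht.1.le, hR.le⟩)
    refine ⟨r, ?_, hrt⟩
    -- If `r` were outside `U`, then `U` would lie in `(0, r]` and the primitive would already equal
    -- one at `r`.
    by_contra hrU
    have hr0 : 0 < r := by
      rcases hr.1.eq_or_lt with h | h
      · rw [← h, hΦ0] at hrt; exact absurd hrt ht.1.ne
      · exact h
    have hsub : U ⊆ Ioc 0 r := fun u hu =>
      ⟨hU0 hu, le_of_not_gt fun h => hrU (hlow u hu r hr0 h.le)⟩
    rw [hval r hr.1, inter_eq_right.2 hsub, h1] at hrt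
    exact ht.2.ne' hrt
  choose! q hqU hqΦ using hex
  have hqmono : StrictMonoOn q (Ioo 0 1) := fun t ht t' ht' h => by
    by_contra hn
    have := hmono.monotoneOn (hqU t' ht') (hqU t ht) (not_lt.1 hn)
    rw [hqΦ t ht, hqΦ t' ht'] at this
    linarith
  have himage : q '' Ioo 0 1 = U := by
    refine Subset.antisymm (image_subset_iff.2 hqU) fun u hu => ⟨Φ u, hmem u hu, ?_⟩
    exact hmono.injOn (hqU _ (hmem u hu)) hu (hqΦ _ (hmem u hu))
  refine ⟨q, hqmono, himage, fun t ht => ?_⟩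
  have hcont : ContinuousAt q t := hqmono.continuousAt_of_image_mem_nhds (isOpen_Ioo.mem_nhds ht)
    (himage ▸ hU.mem_nhds (hqU t ht))
  refine HasDerivAt.of_local_left_inverse hcont (hΦd _ (hqU t ht)) (hpos _ (hqU t ht)).ne' ?_
  filter_upwards [isOpen_Ioo.mem_nhds ht] with y hy using hqΦ y hy

/-! ### Pointwise estimates along the interpolated transport -/

/-- A constant, depending on the dimension `m + 1` only, in the pointwise estimates. -/
noncomputable def pointwiseConst (m : ℕ) : ℝ := (25 + 24 * m) * 2 ^ m

lemma le_pointwiseConst (m : ℕ) : 25 ≤ pointwiseConst m := by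
  have h2m : (1 : ℝ) ≤ 2 ^ m := one_le_pow₀ (by norm_num)
  have h3 : (0 : ℝ) ≤ m := Nat.cast_nonneg m
  unfold pointwiseConst
  nlinarith [mul_nonneg h3 (by linarith : (0 : ℝ) ≤ 2 ^ m)]

section Pointwise

variable {m : ℕ} {l r s r' s' F G θ : ℝ} {H : ℝ → ℝ}

/-- Both quantile equations transport Lebesgue measure on `(0, 1)`, so the quotient of densities is
the quotient of volume elements. This eliminates `F / G` in favour of `x = s / r` and `y = s' / r'`.
-/
lemma transport_ratio (hr : 0 < r) (hs : 0 < s) (hF : 0 < F) (hG : 0 < G)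
    (hr' : r' = (r ^ m * F)⁻¹) (hs' : s' = (s ^ m * G)⁻¹) :
    (s / r) ^ m * (s' / r') = F / G := by
  subst hr' hs'
  rw [div_pow]
  field_simp

lemma transport_mid (hr : 0 < r) (hF : 0 < F) (hr' : r' = (r ^ m * F)⁻¹) :
    (l * r' + (1 - l) * s') * ((l * r + (1 - l) * s) ^ m * H (l * r + (1 - l) * s)) =
      H (l * r + (1 - l) * s) / F * jacobianRatio m l (s / r) (s' / r') := by
  have hr'0 : 0 < r' := by rw [hr']; positivity
  have h1 : l * r + (1 - l) * s = r * (l + (1 - l) * (s / r)) := by field_simp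
  have h2 : l * r' + (1 - l) * s' = r' * (l + (1 - l) * (s' / r')) := by field_simp
  have h3 : r' * r ^ m = 1 / F := by rw [hr']; field_simp
  unfold jacobianRatio
  rw [h2]
  nth_rewrite 1 [h1]
  rw [mul_pow]
  calc _ = (r' * r ^ m) * H (l * r + (1 - l) * s) *
        ((l + (1 - l) * (s / r)) ^ m * (l + (1 - l) * (s' / r'))) := by ring
    _ = _ := by rw [h3]; ring

/-- After division by `F` the hypothesis bounds `H / F` below by `(F / G) ^ (-(1 - l))`. With `F / G
= x ^ m y` this turns the Jacobian ratio into a product of mean ratios. -/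
lemma amgm_le_transport_mid (hl : 1 / 2 ≤ l) (hl1 : l < 1)
    (hr : 0 < r) (hs : 0 < s) (hF : 0 < F) (hG : 0 < G)
    (hr' : r' = (r ^ m * F)⁻¹) (hs' : s' = (s ^ m * G)⁻¹)
    (hPL : F ^ l * G ^ (1 - l) ≤ H (l * r + (1 - l) * s)) :
    amgmRatio l (s / r) ^ m * amgmRatio l (s' / r') ≤
      (l * r' + (1 - l) * s') * ((l * r + (1 - l) * s) ^ m * H (l * r + (1 - l) * s)) := by
  have hr'0 : 0 < r' := by rw [hr']; positivity
  have hs'0 : 0 < s' := by rw [hs']; positivity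
  have hx : 0 < s / r := by positivity
  have hy : 0 < s' / r' := by positivity
  have hw := jacobianRatio_pos (m := m) hl hl1 hx hy
  rw [transport_mid hr hF hr']
  have h1 : amgmRatio l (s / r) ^ m * amgmRatio l (s' / r') =
      jacobianRatio m l (s / r) (s' / r') / (F / G) ^ (1 - l) := by
    rw [← transport_ratio hr hs hF hG hr' hs', Real.mul_rpow (by positivity) hy.le,
      ← Real.rpow_natCast (s / r), ← Real.rpow_mul hx.le, mul_comm (m : ℝ),
      Real.rpow_mul hx.le, Real.rpow_natCast]
    unfold amgmRatio jacobianRatio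
    rw [div_pow, div_mul_div_comm]
  rw [h1, div_eq_inv_mul]
  gcongr
  calc ((F / G) ^ (1 - l))⁻¹ = F ^ l * G ^ (1 - l) / F := by
        rw [Real.div_rpow hF.le hG.le, inv_div, Real.rpow_sub hF, Real.rpow_one]
        have := Real.rpow_pos_of_pos hF l
        field_simp
    _ ≤ _ := by gcongr

/-- The estimates split according to the order of `r` and `s`. On the favourable side monotonicity
of `H` gives a bound by `E`. On the other side a signed difference (`N` minus the quotient for `F`,
or the difference of the two quotients) remains, to be removed by integration. For `m > 0` the
region `s > 2 r` is separate, because the quotient of volume elements is not controlled there. -/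
lemma transport_pointwise (hl : 1 / 2 ≤ l) (hl1 : l < 1) (hθ : 0 < θ) (hθ1 : θ ≤ 1)
    (hr : 0 < r) (hs : 0 < s) (hF : 0 < F) (hG : 0 < G)
    (hr' : r' = (r ^ m * F)⁻¹) (hs' : s' = (s ^ m * G)⁻¹)
    (hH0 : ∀ ρ, 0 < ρ → 0 ≤ H ρ) (hH : AntitoneOn H (Set.Ioi 0))
    (hPL : F ^ l * G ^ (1 - l) ≤ H (l * r + (1 - l) * s))
    {N E : ℝ}
    (hNd : N = (l * r' + (1 - l) * s') * ((l * r + (1 - l) * s) ^ m * H (l * r + (1 - l) * s)))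
    (hE : E = θ + (N - 1) / (1 - l) / θ) :
    1 ≤ N ∧
    (s < r → max (1 - r' * (r ^ m * H r)) 0 ≤
      2 * pointwiseConst m * E + (N - r' * (r ^ m * H r))) ∧
    (r ≤ s → max (1 - r' * (r ^ m * H r)) 0 ≤ 2 * pointwiseConst m * E) ∧
    (s ≤ r → max (1 - s' * (s ^ m * H s)) 0 ≤ pointwiseConst m * E) ∧
    (m ≠ 0 → 2 * r < s → 1 ≤ 25 * ((N - 1) / (1 - l)) ∧
      max (1 - s' * (s ^ m * H s)) 0 ≤ pointwiseConst m * E) ∧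
    (r < s → (m = 0 ∨ s ≤ 2 * r) → max (1 - s' * (s ^ m * H s)) 0 ≤ pointwiseConst m * E +
      max (1 - r' * (r ^ m * H r)) 0 + (r' * (r ^ m * H r) - s' * (s ^ m * H s))) := by
  have hr'0 : 0 < r' := by rw [hr']; positivity
  have hs'0 : 0 < s' := by rw [hs']; positivity
  have hx : 0 < s / r := by positivity
  have hy : 0 < s' / r' := by positivity
  have hw := jacobianRatio_pos (m := m) hl hl1 hx hy
  have hA := amgm_le_transport_mid hl hl1 hr hs hF hG hr' hs' hPL
  rw [← hNd] at hA
  have hz0 : 0 < l * r + (1 - l) * s := by nlinarith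
  have hl0 : 0 ≤ 1 - l := by linarith
  have hzr : s ≤ r → l * r + (1 - l) * s ≤ r := fun h => by
    linarith [mul_le_mul_of_nonneg_left h hl0]
  have hrz : r ≤ s → r ≤ l * r + (1 - l) * s := fun h => by
    linarith [mul_le_mul_of_nonneg_left h hl0]
  have hsz : s ≤ r → s ≤ l * r + (1 - l) * s := fun h => by
    linarith [mul_le_mul_of_nonneg_left h (by linarith : 0 ≤ l)]
  have hzs : r ≤ s → l * r + (1 - l) * s ≤ s := fun h => by
    linarith [mul_le_mul_of_nonneg_left h (by linarith : 0 ≤ l)]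
  have hrat := transport_ratio hr hs hF hG hr' hs'
  have hmid : N = H (l * r + (1 - l) * s) / F * jacobianRatio m l (s / r) (s' / r') := by
    rw [hNd, transport_mid hr hF hr']
  have hN1 := one_le_of_amgm_le hl hl1 hx hy hA
  have hd : 0 ≤ (N - 1) / (1 - l) := div_nonneg (by linarith) (by linarith)
  have hE0 : 0 ≤ E := by rw [hE]; positivity
  have hdE : (N - 1) / (1 - l) ≤ E := by
    have := le_div_self_of_le_one hd hθ hθ1
    rw [hE]; linarith
  have hC := le_pointwiseConst m
  have h2m : (0 : ℝ) < 2 ^ m := by positivity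
  have h3 : (0 : ℝ) ≤ m * 2 ^ m := by positivity
  have hb1 := mul_abs_one_sub_inv_jacobianRatio_le (m := m) hl hl1 hx hy hθ hθ1 hA
  have hb2 := fun h => one_sub_jacobian_quotient_le (m := m) hl hl1 hx hy hθ h hA
  have hb4 := fun h h' => mul_jacobian_quotient_sub_one_le (m := m) hl hl1 hx hy hθ hθ1 h h' hA
  have hb3 := fun hm h => one_le_excess_of_two_le (m := m) hl hl1 hy hm h hA
  rw [← hE] at hb1 hb2 hb4
  rw [hrat] at hb2 hb4
  set w := jacobianRatio m l (s / r) (s' / r') with hwd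
  set z := l * r + (1 - l) * s with hz
  have hHa : r' * (r ^ m * H r) = H r / F := by rw [hr']; field_simp
  have hHb : s' * (s ^ m * H s) = H s / G := by rw [hs']; field_simp
  rw [hHa, hHb]
  have hzF : H z / F = N / w := by rw [hmid]; field_simp
  have hzG : H z / G = N * (F / G / w) := by rw [hmid]; field_simp
  clear hA hmid hNd hHa hHb hrat hE hPL
  clear_value w z
  have hb1' : |N - N / w| ≤ pointwiseConst m * E := by
    have h4 : N - N / w = N * (1 - 1 / w) := by ring
    rw [h4, abs_mul, abs_of_nonneg (by linarith)]
    refine hb1.trans ?_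
    gcongr
    unfold pointwiseConst
    nlinarith
  have hb1'' := abs_le.1 hb1'
  have hCE : 0 ≤ pointwiseConst m * E := by positivity
  -- The bound on `1 - H r / F` or `1 - H s / G` alone would be immediate in the two signed cases.
  -- The content there is that the right side is nonnegative, which needs the upper bounds `H r / F
  -- ≤ N / w` and `H s / G ≤ N (F / G / w)`.
  refine ⟨hN1, fun h => ?_, fun h => ?_, fun h => ?_, fun hm h => ?_, fun h hm => ?_⟩
  · have h1 : H r ≤ H z := hH hz0 hr (hzr h.le)
    have h2 : H r / F ≤ N / w := by rw [← hzF]; gcongr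
    exact max_le (by linarith) (by linarith)
  · have h1 : H z ≤ H r := hH hr hz0 (hrz h)
    have h2 : N / w ≤ H r / F := by rw [← hzF]; gcongr
    exact max_le (by linarith) (by linarith)
  · have h1 : H z ≤ H s := hH hs hz0 (hsz h)
    have h2 : F / G / w ≤ H s / G := by
      calc F / G / w ≤ N * (F / G / w) := le_mul_of_one_le_left (by positivity) hN1
        _ = H z / G := hzG.symm
        _ ≤ _ := by gcongr
    have h4 := hb2 ((div_le_one hr).2 h)
    refine max_le ?_ hCE
    have : (4 + 4 * m) * 2 ^ m * E ≤ pointwiseConst m * E := by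
      gcongr
      unfold pointwiseConst
      nlinarith
    linarith
  · have h1 := hb3 hm ((le_div_iff₀ hr).2 h.le)
    refine ⟨h1, max_le ?_ hCE⟩
    have h4 : 0 ≤ H s / G := div_nonneg (hH0 s hs) hG.le
    have h5 : 25 * E ≤ pointwiseConst m * E := by gcongr
    linarith
  · have h1 : H s ≤ H z := hH hz0 hs (hzs h.le)
    have h2 : H s / G ≤ N * (F / G / w) := by rw [← hzG]; gcongr
    have h4 := hb4 ((one_le_div hr).2 h.le) (hm.imp id fun h => (div_le_iff₀ hr).2 h)
    change _ ≤ pointwiseConst m * E at h4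
    have h5 := le_max_left (1 - H r / F) 0
    have h6 := le_max_right (1 - H r / F) 0
    exact max_le (by linarith) (by linarith)

end Pointwise

/-! ### Integrated transport estimates on the half-line -/

lemma setIntegral_le_add_of_subset_union {g : ℝ → ℝ} {A B C : Set ℝ} (h : A ⊆ B ∪ C)
    (hB : IntegrableOn g B) (hC : IntegrableOn g C)
    (hgB : 0 ≤ᵐ[volume.restrict B] g) (hgC : 0 ≤ᵐ[volume.restrict C] g) :
    ∫ x in A, g x ≤ (∫ x in B, g x) + ∫ x in C, g x := by
  rw [← integral_add_measure hB hC]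
  refine integral_mono_measure ?_ ?_ (Integrable.add_measure hB hC)
  · exact (Measure.restrict_mono h le_rfl).trans (Measure.restrict_union_le B C)
  · exact ae_add_measure_iff.2 ⟨hgB, hgC⟩

/-- A density with respect to `r ^ m dr` on the half-line that is positive and continuous on an open
interval `U` starting at `0`, and that vanishes off `U`. -/
structure IsRegularDensity (m : ℕ) (F : ℝ → ℝ) (U : Set ℝ) : Prop where
  isOpen : IsOpen U
  subset : U ⊆ Set.Ioi 0
  lower : ∀ r ∈ U, ∀ s, 0 < s → s ≤ r → s ∈ U
  continuousOn : ContinuousOn F U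
  pos : ∀ r ∈ U, 0 < F r
  zero : ∀ r, 0 < r → r ∉ U → F r = 0
  integrableOn : IntegrableOn (fun r => r ^ m * F r) (Set.Ioi 0)

lemma IsRegularDensity.setIntegral_eq {m : ℕ} {F : ℝ → ℝ} {U : Set ℝ}
    (h : IsRegularDensity m F U) {k : ℝ → ℝ → ℝ} (hk : ∀ r, 0 < r → k r 0 = 0) :
    ∫ r in Set.Ioi 0, k r (F r) = ∫ r in U, k r (F r) := by
  refine setIntegral_eq_of_subset_of_forall_sdiff_eq_zero measurableSet_Ioi h.subset fun r hr => ?_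
  rw [h.zero r hr.1 hr.2, hk r hr.1]

open Set in
lemma IsRegularDensity.exists_quantile {m : ℕ} {F : ℝ → ℝ} {U : Set ℝ}
    (h : IsRegularDensity m F U) (h1 : ∫ r in Ioi 0, r ^ m * F r = 1) :
    ∃ q : ℝ → ℝ, StrictMonoOn q (Ioo 0 1) ∧ q '' Ioo 0 1 = U ∧
      ∀ t ∈ Ioo (0 : ℝ) 1, HasDerivAt q (q t ^ m * F (q t))⁻¹ t := by
  refine _root_.exists_quantile (P := fun r => r ^ m * F r) h.isOpen h.subset h.lower
    ((continuous_pow m).continuousOn.mul h.continuousOn)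
    (fun r hr => mul_pos (pow_pos (h.subset hr) m) (h.pos r hr))
    (h.integrableOn.mono_set h.subset) ?_
  rw [← h.setIntegral_eq (k := fun r v => r ^ m * v) (fun r _ => by simp), h1]

/-- From `|u| = 2 u₊ - u`: only the positive part of `F - H` has to be estimated, the masses being
known. -/
lemma setIntegral_abs_sub_eq {m : ℕ} {F H : ℝ → ℝ}
    (hF : IntegrableOn (fun r => r ^ m * F r) (Set.Ioi 0))
    (hH : IntegrableOn (fun r => r ^ m * H r) (Set.Ioi 0)) :
    ∫ r in Set.Ioi 0, r ^ m * |F r - H r| =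
      2 * (∫ r in Set.Ioi 0, r ^ m * max (F r - H r) 0) +
        ((∫ r in Set.Ioi 0, r ^ m * H r) - ∫ r in Set.Ioi 0, r ^ m * F r) := by
  have h1 : IntegrableOn (fun r => r ^ m * max (F r - H r) 0) (Set.Ioi 0) := by
    refine ((hF.sub hH).sup (integrable_zero _ _ _)).congr ?_
    filter_upwards [ae_restrict_mem measurableSet_Ioi] with r hr
    have : 0 ≤ r ^ m := pow_nonneg (le_of_lt hr) m
    simp only [Pi.sup_apply, Pi.sub_apply, Pi.zero_apply]
    rw [← mul_sub, mul_max_of_nonneg _ _ this, mul_zero]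
  rw [← integral_const_mul, ← integral_sub hH hF, 
    ← integral_add (g := fun r => r ^ m * H r - r ^ m * F r) (h1.const_mul 2) (hH.sub hF)]
  refine integral_congr_ae (Filter.Eventually.of_forall fun r => ?_)
  dsimp only
  rcases le_total (F r) (H r) with h | h
  · rw [abs_of_nonpos (by linarith), max_eq_right (by linarith)]; ring
  · rw [abs_of_nonneg (by linarith), max_eq_left (by linarith)]; ring

-- Substituting `r = q t` turns integrals against `r ^ m F` into integrals over `(0, 1)`. The mass
-- of `H` off `U` is lost, hence an inequality in the second claim; the positive part vanishes off
-- `U`, hence an equality in the third.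
open Set in
lemma transport_l1_bound {m : ℕ} {F H q : ℝ → ℝ} {U : Set ℝ} (hF : IsRegularDensity m F U)
    (hH0 : ∀ ρ, 0 < ρ → 0 ≤ H ρ) (hHi : IntegrableOn (fun r => r ^ m * H r) (Ioi 0))
    (hq : StrictMonoOn q (Ioo 0 1)) (himg : q '' Ioo 0 1 = U)
    (hder : ∀ t ∈ Ioo (0 : ℝ) 1, HasDerivAt q (q t ^ m * F (q t))⁻¹ t) :
    IntegrableOn (fun t => (q t ^ m * F (q t))⁻¹ * (q t ^ m * H (q t))) (Ioo 0 1) ∧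
    ∫ t in Ioo 0 1, (q t ^ m * F (q t))⁻¹ * (q t ^ m * H (q t)) ≤ ∫ r in Ioi 0, r ^ m * H r ∧
    ∫ r in Ioi 0, r ^ m * max (F r - H r) 0 =
      ∫ t in Ioo 0 1, max (1 - (q t ^ m * F (q t))⁻¹ * (q t ^ m * H (q t))) 0 := by
  have hd : ∀ t ∈ Ioo (0 : ℝ) 1, HasDerivWithinAt q (q t ^ m * F (q t))⁻¹ (Ioo 0 1) t :=
    fun t ht => (hder t ht).hasDerivWithinAt
  have hmem : ∀ t ∈ Ioo (0 : ℝ) 1, q t ∈ U := fun t ht => himg ▸ mem_image_of_mem q ht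
  refine ⟨?_, ?_, ?_⟩
  · have := (integrableOn_image_iff_integrableOn_deriv_smul_of_monotoneOn measurableSet_Ioo hd
      hq.monotoneOn (fun r => r ^ m * H r)).1 (himg ▸ hHi.mono_set hF.subset)
    exact this
  · have := integral_image_eq_integral_deriv_smul_of_monotoneOn measurableSet_Ioo hd
      hq.monotoneOn (fun r => r ^ m * H r)
    simp only [smul_eq_mul] at this
    rw [← this, himg]
    refine setIntegral_mono_set hHi ?_ (Filter.Eventually.of_forall hF.subset)
    filter_upwards [ae_restrict_mem measurableSet_Ioi] with r hr
    exact mul_nonneg (pow_nonneg (le_of_lt hr) m) (hH0 r hr)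
  · rw [setIntegral_eq_of_subset_of_forall_sdiff_eq_zero measurableSet_Ioi hF.subset, ← himg,
      integral_image_eq_integral_deriv_smul_of_monotoneOn measurableSet_Ioo hd hq.monotoneOn]
    · refine setIntegral_congr_fun measurableSet_Ioo fun t ht => ?_
      have h1 := hF.pos _ (hmem t ht)
      have h2 : 0 < q t := hF.subset (hmem t ht)
      have h3 : 0 < q t ^ m := pow_pos h2 m
      simp only [smul_eq_mul]
      have h4 : 0 ≤ (q t ^ m * F (q t))⁻¹ * q t ^ m := by positivity
      rw [← mul_assoc, mul_max_of_nonneg _ _ h4, mul_zero]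
      congr 1
      field_simp
    · intro r hr
      rw [hF.zero r hr.1 hr.2, max_eq_right (by linarith [hH0 r hr.1]), mul_zero]

/-- The constant, depending on the dimension `m + 1` only, in the stability estimate for transported
densities. -/
noncomputable def transportConst (m : ℕ) : ℝ :=
  2 * (6 * pointwiseConst m + 2 ^ (m + 1) * (8 * pointwiseConst m + 26)) + 1

-- The analytic core, for the larger weight on `F`. Integrating `transport_pointwise` leaves two
-- signed terms, each controlled by comparing image sets of the transport maps.
open Set in
set_option maxHeartbeats 1000000 in
lemma transport_stability_aux {m : ℕ} {l θ : ℝ} {F G H : ℝ → ℝ} {U V : Set ℝ}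
    (hl : 1 / 2 ≤ l) (hl1 : l < 1) (hθ : 0 < θ) (hθ1 : θ ≤ 1)
    (hF : IsRegularDensity m F U) (hG : IsRegularDensity m G V)
    (hF1 : ∫ r in Ioi 0, r ^ m * F r = 1) (hG1 : ∫ r in Ioi 0, r ^ m * G r = 1)
    (hH0 : ∀ ρ, 0 < ρ → 0 ≤ H ρ) (hHa : AntitoneOn H (Ioi 0))
    (hHi : IntegrableOn (fun r => r ^ m * H r) (Ioi 0))
    (hPL : ∀ r ∈ U, ∀ s ∈ V, F r ^ l * G s ^ (1 - l) ≤ H (l * r + (1 - l) * s))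
    (hle : ∫ r in Ioi 0, r ^ m * H r ≤ 1 + (1 - l) * θ ^ 2) :
    1 ≤ ∫ r in Ioi 0, r ^ m * H r ∧
    ∫ r in Ioi 0, r ^ m * |F r - H r| ≤ transportConst m * θ ∧
    ∫ r in Ioi 0, r ^ m * |G r - H r| ≤ transportConst m * θ := by
  obtain ⟨q, hq, hqU, hqd⟩ := hF.exists_quantile hF1
  obtain ⟨p, hp, hpV, hpd⟩ := hG.exists_quantile hG1
  obtain ⟨hai, hale, haF⟩ := transport_l1_bound hF hH0 hHi hq hqU hqd
  obtain ⟨hbi, -, hbG⟩ := transport_l1_bound hG hH0 hHi hp hpV hpd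
  set I : Set ℝ := Ioo 0 1 with hI
  have hImeas : MeasurableSet I := measurableSet_Ioo
  set q' : ℝ → ℝ := fun t => (q t ^ m * F (q t))⁻¹ with hq'
  set p' : ℝ → ℝ := fun t => (p t ^ m * G (p t))⁻¹ with hp'
  set h : ℝ → ℝ := fun r => r ^ m * H r with hh
  set a : ℝ → ℝ := fun t => q' t * h (q t) with ha
  set b : ℝ → ℝ := fun t => p' t * h (p t) with hb
  set z : ℝ → ℝ := fun t => l * q t + (1 - l) * p t with hz
  set N : ℝ → ℝ := fun t => (l * q' t + (1 - l) * p' t) * h (z t) with hN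
  change IntegrableOn a I at hai
  change IntegrableOn b I at hbi
  change ∫ t in I, a t ≤ _ at hale
  change _ = ∫ t in I, max (1 - a t) 0 at haF
  change _ = ∫ t in I, max (1 - b t) 0 at hbG
  have hqm : ∀ t ∈ I, q t ∈ U := fun t ht => hqU ▸ mem_image_of_mem q ht
  have hpm : ∀ t ∈ I, p t ∈ V := fun t ht => hpV ▸ mem_image_of_mem p ht
  have hq0 : ∀ t ∈ I, 0 < q t := fun t ht => hF.subset (hqm t ht)
  have hp0 : ∀ t ∈ I, 0 < p t := fun t ht => hG.subset (hpm t ht)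
  have hl0 : 0 < 1 - l := by linarith
  have hh0 : ∀ r, 0 < r → 0 ≤ h r := fun r hr => mul_nonneg (pow_nonneg hr.le m) (hH0 r hr)
  have hh0' : ∀ S ⊆ Ioi (0 : ℝ), 0 ≤ᵐ[volume.restrict S] h := fun S hS =>
    ae_restrict_of_ae_restrict_of_subset hS
      ((ae_restrict_mem measurableSet_Ioi).mono fun r hr => hh0 r hr)
  have hzmono : StrictMonoOn z I := fun t ht t' ht' h => by
    have h1 := hq ht ht' h
    have h2 := hp ht ht' h
    simp only [hz]
    nlinarith
  have hzd : ∀ t ∈ I, HasDerivAt z (l * q' t + (1 - l) * p' t) t := fun t ht =>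
    ((hqd t ht).const_mul l).add ((hpd t ht).const_mul (1 - l))
  have hz0 : ∀ t ∈ I, 0 < z t := fun t ht => by
    have h1 := hq0 t ht
    have h2 := hp0 t ht
    simp only [hz]; positivity
  have hzimg : z '' I ⊆ Ioi 0 := image_subset_iff.2 hz0
  have hNi : IntegrableOn N I :=
    (integrableOn_image_iff_integrableOn_deriv_smul_of_monotoneOn hImeas
      (fun t ht => (hzd t ht).hasDerivWithinAt) hzmono.monotoneOn h).1 (hHi.mono_set hzimg)
  have hNle : ∫ t in I, N t ≤ ∫ r in Ioi 0, h r := by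
    have := integral_image_eq_integral_deriv_smul_of_monotoneOn hImeas
      (fun t ht => (hzd t ht).hasDerivWithinAt) hzmono.monotoneOn h
    simp only [smul_eq_mul] at this
    rw [← this]
    exact setIntegral_mono_set hHi (hh0' _ subset_rfl) (Filter.Eventually.of_forall hzimg)
  set E : ℝ → ℝ := fun t => θ + (N t - 1) / (1 - l) / θ with hE
  set C := pointwiseConst m with hC
  have hC25 : 25 ≤ C := le_pointwiseConst m
  have hpt := fun t (ht : t ∈ I) => transport_pointwise (m := m) hl hl1 hθ hθ1 (hq0 t ht) (hp0 t ht)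
    (hF.pos _ (hqm t ht)) (hG.pos _ (hpm t ht)) rfl rfl hH0 hHa
    (hPL _ (hqm t ht) _ (hpm t ht)) (N := N t) (E := E t) rfl rfl
  have hvol : volume.real I = 1 := by simp [hI]
  have hvol' : volume I ≠ ⊤ := by simp [hI]
  have hcint : ∀ c : ℝ, IntegrableOn (fun _ => c) I := fun c => integrableOn_const hvol'
  have hNge : 1 ≤ ∫ t in I, N t := by
    have := setIntegral_mono_on (hcint 1) hNi hImeas fun t ht => (hpt t ht).1
    rwa [setIntegral_const, hvol, smul_eq_mul, one_mul] at this
  have hdi : IntegrableOn (fun t => (N t - 1) / (1 - l)) I := (hNi.sub (hcint 1)).div_const _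
  have hdint : ∫ t in I, (N t - 1) / (1 - l) ≤ θ ^ 2 := by
    rw [integral_div, integral_sub hNi (hcint 1), setIntegral_const, hvol, div_le_iff₀ hl0]
    simp only [smul_eq_mul]
    linarith
  have hEi : IntegrableOn E I := (hcint θ).add (hdi.div_const θ)
  have hEint : ∫ t in I, E t ≤ 2 * θ := by
    rw [hE, integral_add (hcint θ) (hdi.div_const θ), integral_div, setIntegral_const, hvol]
    have : (∫ t in I, (N t - 1) / (1 - l)) / θ ≤ θ := by
      rw [div_le_iff₀ hθ]; linarith
    simp only [smul_eq_mul]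
    linarith
  have hqc : ContinuousOn q I := fun t ht => (hqd t ht).continuousAt.continuousWithinAt
  have hpc : ContinuousOn p I := fun t ht => (hpd t ht).continuousAt.continuousWithinAt
  -- the set where the second quantile is smaller
  set S : Set ℝ := I ∩ (fun t => q t - p t) ⁻¹' Ioi 0 with hS
  have hSm : MeasurableSet S := ((hqc.sub hpc).isOpen_inter_preimage isOpen_Ioo isOpen_Ioi).measurableSet
  have hSI : S ⊆ I := inter_subset_left
  -- Both integrals are integrals of `h`, over `z '' S` and `q '' S`. The first set lies in the
  -- second: if `z t = q t'` then `t' < t`, so `p t' < p t < z t = q t'` and `t' ∈ S`.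
  have hSint : ∫ t in S, (N t - a t) ≤ 0 := by
    rw [integral_sub (hNi.mono_set hSI) (hai.mono_set hSI)]
    have h1 := integral_image_eq_integral_deriv_smul_of_monotoneOn hSm
      (fun t ht => (hzd t (hSI ht)).hasDerivWithinAt) (hzmono.monotoneOn.mono hSI) h
    have h2 := integral_image_eq_integral_deriv_smul_of_monotoneOn hSm
      (fun t ht => (hqd t (hSI ht)).hasDerivWithinAt) (hq.monotoneOn.mono hSI) h
    simp only [smul_eq_mul] at h1 h2
    change _ = ∫ t in S, N t at h1
    change _ = ∫ t in S, a t at h2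
    rw [← h1, ← h2, sub_nonpos]
    have hqS : q '' S ⊆ Ioi 0 := image_subset_iff.2 fun t ht => hq0 t (hSI ht)
    refine setIntegral_mono_set (hHi.mono_set hqS) (hh0' _ hqS) (Filter.Eventually.of_forall ?_)
    rintro _ ⟨t, ⟨ht, hlt⟩, rfl⟩
    have hlt' : p t < q t := sub_pos.1 hlt
    have hzq : z t < q t := by simp only [hz]; nlinarith
    have hpz : p t < z t := by simp only [hz]; nlinarith
    obtain ⟨t', ht', hqt'⟩ : z t ∈ q '' I := hqU ▸ hF.lower _ (hqm t ht) _ (hz0 t ht) hzq.le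
    have htt : t' < t := (hq.lt_iff_lt ht' ht).1 (hqt' ▸ hzq)
    have hpq : p t' < q t' := hqt' ▸ (hp ht' ht htt).trans hpz
    exact ⟨t', ⟨ht', sub_pos.2 hpq⟩, hqt'⟩
  have hai1 : IntegrableOn (fun t => max (1 - a t) 0) I :=
    ((hcint 1).sub hai).sup (integrable_zero _ _ _)
  have hbi1 : IntegrableOn (fun t => max (1 - b t) 0) I :=
    ((hcint 1).sub hbi).sup (integrable_zero _ _ _)
  have hstepF : ∫ t in I, max (1 - a t) 0 ≤ 4 * C * θ := by
    have hg : IntegrableOn (S.indicator fun t => N t - a t) I :=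
      IntegrableOn.indicator (hNi.sub hai) hSm
    have h1 : ∫ t in I, max (1 - a t) 0 ≤
        ∫ t in I, (2 * C * E t + S.indicator (fun t => N t - a t) t) := by
      refine setIntegral_mono_on hai1 ((hEi.const_mul (2 * C)).add hg) hImeas fun t ht => ?_
      by_cases htS : t ∈ S
      · rw [indicator_of_mem htS]
        exact (hpt t ht).2.1 (sub_pos.1 htS.2)
      · rw [indicator_of_notMem htS, add_zero]
        exact (hpt t ht).2.2.1 (not_lt.1 fun hlt => htS ⟨ht, sub_pos.2 hlt⟩)
    rw [integral_add (hEi.const_mul (2 * C)) hg, integral_const_mul, setIntegral_indicator hSm,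
      inter_eq_right.2 hSI] at h1
    nlinarith
  -- the sets where the second quantile is moderately, respectively much, larger
  have hA : ∀ k : ℝ, MeasurableSet (I ∩ (fun t => p t - k * q t) ⁻¹' Ioi 0) := fun k =>
    ((hpc.sub (continuousOn_const.mul hqc)).isOpen_inter_preimage isOpen_Ioo isOpen_Ioi).measurableSet
  -- Empty for `m = 0`, where no cutoff is needed and no lower bound on `d` from `x` is available.
  obtain ⟨O₂, hO₂m, hO₂I, hO₂⟩ : ∃ O₂ : Set ℝ, MeasurableSet O₂ ∧ O₂ ⊆ I ∧
      ∀ t ∈ I, t ∈ O₂ ↔ m ≠ 0 ∧ 2 * q t < p t := by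
    rcases eq_or_ne m 0 with hm | hm
    · exact ⟨∅, MeasurableSet.empty, empty_subset _, fun t _ => by simp [hm]⟩
    · refine ⟨_, hA 2, inter_subset_left, fun t ht => ⟨fun h => ⟨hm, sub_pos.1 h.2⟩,
        fun h => ⟨ht, sub_pos.2 h.2⟩⟩⟩
  set O₁ : Set ℝ := (I ∩ (fun t => p t - 1 * q t) ⁻¹' Ioi 0) \ O₂ with hO₁
  have hO₁m : MeasurableSet O₁ := (hA 1).diff hO₂m
  have hO₁I : O₁ ⊆ I := sdiff_subset.trans inter_subset_left
  have hmemO₁ : ∀ t ∈ I, q t < p t → t ∉ O₂ → t ∈ O₁ := fun t ht hlt hn =>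
    ⟨⟨ht, by simpa using hlt⟩, hn⟩
  have hO₁lt : ∀ t ∈ O₁, q t < p t ∧ (m = 0 ∨ p t ≤ 2 * q t) := fun t ht => by
    refine ⟨by simpa using ht.1.2, ?_⟩
    by_contra! hc
    exact ht.2 ((hO₂ t (hO₁I ht)).2 hc)
  -- The analogous inclusion can fail because `O₂` was removed, and the missing part is covered by
  -- `2 q(O₂)`. Rescaling by two costs `2 ^ (m + 1)`, as `H` is non-increasing.
  have hO₁int : ∫ t in O₁, (a t - b t) ≤ 2 ^ (m + 1) * ∫ t in O₂, a t := by
    have h1 := integral_image_eq_integral_deriv_smul_of_monotoneOn hO₁m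
      (fun t ht => (hqd t (hO₁I ht)).hasDerivWithinAt) (hq.monotoneOn.mono hO₁I) h
    have h2 := integral_image_eq_integral_deriv_smul_of_monotoneOn hO₁m
      (fun t ht => (hpd t (hO₁I ht)).hasDerivWithinAt) (hp.monotoneOn.mono hO₁I) h
    have h3d : ∀ t ∈ O₂, HasDerivWithinAt (fun t => 2 * q t) (2 * q' t) O₂ t := fun t ht =>
      ((hqd t (hO₂I ht)).const_mul 2).hasDerivWithinAt
    have h3m : MonotoneOn (fun t => 2 * q t) O₂ := fun t ht t' ht' hle => by
      have := hq.monotoneOn (hO₂I ht) (hO₂I ht') hle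
      dsimp only; linarith
    have h3 := integral_image_eq_integral_deriv_smul_of_monotoneOn hO₂m h3d h3m h
    simp only [smul_eq_mul] at h1 h2 h3
    change _ = ∫ t in O₁, a t at h1
    change _ = ∫ t in O₁, b t at h2
    have hqO : q '' O₁ ⊆ Ioi 0 := image_subset_iff.2 fun t ht => hq0 t (hO₁I ht)
    have hpO : p '' O₁ ⊆ Ioi 0 := image_subset_iff.2 fun t ht => hp0 t (hO₁I ht)
    have h2qO : (fun t => 2 * q t) '' O₂ ⊆ Ioi 0 := image_subset_iff.2 fun t ht => by
      have := hq0 t (hO₂I ht)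
      simpa using this
    have hsub : q '' O₁ ⊆ p '' O₁ ∪ (fun t => 2 * q t) '' O₂ := by
      rintro _ ⟨t, ht, rfl⟩
      have htI := hO₁I ht
      obtain ⟨t', ht', hpt'⟩ : q t ∈ p '' I :=
        hpV ▸ hG.lower _ (hpm t htI) _ (hq0 t htI) (hO₁lt t ht).1.le
      have htt : t' < t := (hp.lt_iff_lt ht' htI).1 (hpt' ▸ (hO₁lt t ht).1)
      have hqp : q t' < p t' := hpt' ▸ hq ht' htI htt
      by_cases hc : t' ∈ O₂
      · right
        have h4 := (hO₂ t' ht').1 hc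
        have hq0t := hq0 t htI
        -- Here `p t' = q t > 2 q t'`, so `t' < u` and `p u > p t' = q t = 2 q u`. Thus `u ∈ O₂` and
        -- `q t = 2 q u`.
        obtain ⟨u, hu, hqu⟩ : q t / 2 ∈ q '' I :=
          hqU ▸ hF.lower _ (hqm t htI) _ (by linarith) (by linarith)
        have htu : t' < u := (hq.lt_iff_lt ht' hu).1 (by rw [hqu, ← hpt']; linarith [h4.2])
        have hpu := hp ht' hu htu
        refine ⟨u, (hO₂ u hu).2 ⟨h4.1, ?_⟩, ?_⟩
        · rw [hqu]; linarith
        · dsimp only; rw [hqu]; ring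
      · exact Or.inl ⟨t', hmemO₁ t' ht' hqp hc, hpt'⟩
    have h4 : ∫ t in O₂, 2 * q' t * h (2 * q t) ≤ ∫ t in O₂, 2 ^ (m + 1) * a t := by
      refine setIntegral_mono_on ?_ ((hai.mono_set hO₂I).const_mul _) hO₂m fun t ht => ?_
      · exact (integrableOn_image_iff_integrableOn_deriv_smul_of_monotoneOn hO₂m h3d h3m h).1
          (hHi.mono_set h2qO)
      · have hqt := hq0 t (hO₂I ht)
        have hFt := hF.pos _ (hqm t (hO₂I ht))
        have hqt' : 0 ≤ q' t := by simp only [hq']; positivity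
        have hHle : H (2 * q t) ≤ H (q t) := hHa hqt (mul_pos two_pos hqt : 0 < 2 * q t) (by linarith)
        simp only [ha, hh]
        calc 2 * q' t * ((2 * q t) ^ m * H (2 * q t))
            ≤ 2 * q' t * ((2 * q t) ^ m * H (q t)) := by gcongr
          _ = _ := by rw [mul_pow, pow_succ]; ring
    have h5 := setIntegral_le_add_of_subset_union hsub (hHi.mono_set hpO) (hHi.mono_set h2qO)
      (hh0' _ hpO) (hh0' _ h2qO)
    rw [integral_const_mul] at h4
    rw [integral_sub (hai.mono_set hO₁I) (hbi.mono_set hO₁I), ← h1, ← h2]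
    linarith
  have habs : IntegrableOn (fun t => |a t - 1|) I := (hai.sub (hcint 1)).abs
  have habsint : ∫ t in I, |a t - 1| ≤ 8 * C * θ + θ := by
    have h1 : ∫ t in I, |a t - 1| = ∫ t in I, (2 * max (1 - a t) 0 + (a t - 1)) := by
      refine integral_congr_ae (Filter.Eventually.of_forall fun t => ?_)
      dsimp only
      rcases le_total (a t) 1 with hc | hc
      · rw [abs_of_nonpos (by linarith), max_eq_left (by linarith)]; ring
      · rw [abs_of_nonneg (by linarith), max_eq_right (by linarith)]; ring
    rw [h1, integral_add (g := fun t => a t - 1) (hai1.const_mul 2) (hai.sub (hcint 1)),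
      integral_const_mul,
      integral_sub hai (hcint 1), setIntegral_const, hvol, smul_eq_mul]
    nlinarith
  -- On `O₂` one has `1 ≤ 25 d`, hence `a ≤ |a - 1| + 25 d`, and both terms have small integral.
  have hO₂int : ∫ t in O₂, a t ≤ 8 * C * θ + 26 * θ := by
    have hi := habs.add (hdi.const_mul 25)
    have h0 : ∀ t ∈ I, 0 ≤ |a t - 1| + 25 * ((N t - 1) / (1 - l)) := fun t ht => by
      have := (hpt t ht).1
      have : 0 ≤ (N t - 1) / (1 - l) := div_nonneg (by linarith) hl0.le
      positivity
    calc ∫ t in O₂, a t ≤ ∫ t in O₂, (|a t - 1| + 25 * ((N t - 1) / (1 - l))) := by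
          refine setIntegral_mono_on (hai.mono_set hO₂I) (hi.mono_set hO₂I) hO₂m fun t ht => ?_
          have h1 := (hO₂ t (hO₂I ht)).1 ht
          have h2 := ((hpt t (hO₂I ht)).2.2.2.2.1 h1.1 h1.2).1
          have h3 := le_abs_self (a t - 1)
          linarith
      _ ≤ ∫ t in I, (|a t - 1| + 25 * ((N t - 1) / (1 - l))) :=
          setIntegral_mono_set hi ((ae_restrict_mem hImeas).mono h0)
            (Filter.Eventually.of_forall hO₂I)
      _ ≤ _ := by
          rw [integral_add habs (hdi.const_mul 25), integral_const_mul]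
          nlinarith
  have hstepG : ∫ t in I, max (1 - b t) 0 ≤
      (6 * C + 2 ^ (m + 1) * (8 * C + 26)) * θ := by
    have hg : IntegrableOn (O₁.indicator fun t => a t - b t) I :=
      IntegrableOn.indicator (hai.sub hbi) hO₁m
    have h1 : ∫ t in I, max (1 - b t) 0 ≤
        ∫ t in I, (C * E t + max (1 - a t) 0 + O₁.indicator (fun t => a t - b t) t) := by
      refine setIntegral_mono_on hbi1 (((hEi.const_mul C).add hai1).add hg) hImeas fun t ht => ?_
      have ha0 : 0 ≤ max (1 - a t) 0 := le_max_right _ _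
      obtain ⟨-, -, -, h4, h5, h6⟩ := hpt t ht
      by_cases htO : t ∈ O₁
      · rw [indicator_of_mem htO]
        exact h6 (hO₁lt t htO).1 (hO₁lt t htO).2
      · rw [indicator_of_notMem htO, add_zero]
        have h7 : max (1 - b t) 0 ≤ C * E t := by
          rcases le_or_gt (p t) (q t) with hc | hc
          · exact h4 hc
          · by_cases htO₂ : t ∈ O₂
            · have h8 := (hO₂ t ht).1 htO₂
              exact (h5 h8.1 h8.2).2
            · exact absurd (hmemO₁ t ht hc htO₂) htO
        linarith
    rw [integral_add (f := fun t => C * E t + max (1 - a t) 0) ((hEi.const_mul C).add hai1) hg,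
      integral_add (hEi.const_mul C) hai1,
      integral_const_mul, setIntegral_indicator hO₁m, inter_eq_right.2 hO₁I] at h1
    have h2 : (2 : ℝ) ^ (m + 1) * ∫ t in O₂, a t ≤ 2 ^ (m + 1) * (8 * C * θ + 26 * θ) := by
      gcongr
    have h3 : C * ∫ t in I, E t ≤ C * (2 * θ) := by gcongr
    linarith
  have hθ2 : (1 - l) * θ ^ 2 ≤ θ := by nlinarith
  have hpw : (0 : ℝ) < 2 ^ (m + 1) := by positivity
  refine ⟨hNge.trans hNle, ?_, ?_⟩
  · rw [setIntegral_abs_sub_eq hF.integrableOn hHi, haF, hF1, transportConst]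
    nlinarith [mul_pos hpw hθ, mul_pos hθ (by linarith : 0 < C), mul_pos (mul_pos hpw hθ) (by linarith : 0 < C)]
  · rw [setIntegral_abs_sub_eq hG.integrableOn hHi, hbG, hG1, transportConst]
    linarith

lemma IsRegularDensity.div_const {m : ℕ} {F : ℝ → ℝ} {U : Set ℝ} (h : IsRegularDensity m F U)
    {A : ℝ} (hA : 0 < A) : IsRegularDensity m (fun r => F r / A) U where
  isOpen := h.isOpen
  subset := h.subset
  lower := h.lower
  continuousOn := h.continuousOn.div_const A
  pos r hr := div_pos (h.pos r hr) hA
  zero r hr hrU := by rw [h.zero r hr hrU, zero_div]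
  integrableOn := by
    have : Integrable (fun r => r ^ m * F r / A) (volume.restrict (Set.Ioi 0)) :=
      h.integrableOn.div_const A
    simp only [mul_div_assoc] at this
    exact this

-- Exchanging the two densities together with their weights reduces to a first weight of at least
-- `1/2`.
open Set in
lemma transport_stability_of_integral_eq_one {m : ℕ} {lam θ : ℝ} {F G H : ℝ → ℝ} {U V : Set ℝ}
    (hl0 : 0 < lam) (hl1 : lam < 1) (hθ : 0 < θ) (hθ1 : θ ≤ 1)
    (hF : IsRegularDensity m F U) (hG : IsRegularDensity m G V)
    (hF1 : ∫ r in Ioi 0, r ^ m * F r = 1) (hG1 : ∫ r in Ioi 0, r ^ m * G r = 1)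
    (hH0 : ∀ ρ, 0 < ρ → 0 ≤ H ρ) (hHa : AntitoneOn H (Ioi 0))
    (hHi : IntegrableOn (fun r => r ^ m * H r) (Ioi 0))
    (hPL : ∀ r ∈ U, ∀ s ∈ V, F r ^ lam * G s ^ (1 - lam) ≤ H (lam * r + (1 - lam) * s))
    (hle : ∫ r in Ioi 0, r ^ m * H r ≤ 1 + min lam (1 - lam) * θ ^ 2) :
    1 ≤ ∫ r in Ioi 0, r ^ m * H r ∧
    ∫ r in Ioi 0, r ^ m * |F r - H r| ≤ transportConst m * θ ∧
    ∫ r in Ioi 0, r ^ m * |G r - H r| ≤ transportConst m * θ := by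
  rcases le_total (1 / 2) lam with h | h
  · rw [min_eq_right (by linarith)] at hle
    exact transport_stability_aux h hl1 hθ hθ1 hF hG hF1 hG1 hH0 hHa hHi hPL hle
  · rw [min_eq_left (by linarith)] at hle
    obtain ⟨h1, h2, h3⟩ := transport_stability_aux (l := 1 - lam) (by linarith) (by linarith) hθ hθ1
      hG hF hG1 hF1 hH0 hHa hHi (fun s hs r hr => by
        have := hPL r hr s hs
        rwa [sub_sub_cancel, mul_comm, add_comm]) (by rwa [sub_sub_cancel])
    exact ⟨h1, h3, h2⟩

lemma rpow_mul_rpow_one_sub_pos {A B lam : ℝ} (hA : 0 < A) (hB : 0 < B) :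
    0 < A ^ lam * B ^ (1 - lam) :=
  mul_pos (Real.rpow_pos_of_pos hA _) (Real.rpow_pos_of_pos hB _)

open Set in
lemma transport_stability {m : ℕ} {lam ε θ A B : ℝ} {F G H : ℝ → ℝ} {U V : Set ℝ}
    (hl0 : 0 < lam) (hl1 : lam < 1) (hθ : 0 < θ) (hθ1 : θ ≤ 1)
    (hF : IsRegularDensity m F U) (hG : IsRegularDensity m G V) (hA : 0 < A) (hB : 0 < B)
    (hFA : ∫ r in Ioi 0, r ^ m * F r = A) (hGB : ∫ r in Ioi 0, r ^ m * G r = B)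
    (hH0 : ∀ ρ, 0 < ρ → 0 ≤ H ρ) (hHa : AntitoneOn H (Ioi 0))
    (hHi : IntegrableOn (fun r => r ^ m * H r) (Ioi 0))
    (hPL : ∀ r ∈ U, ∀ s ∈ V, F r ^ lam * G s ^ (1 - lam) ≤ H (lam * r + (1 - lam) * s))
    (hle : ∫ r in Ioi 0, r ^ m * H r ≤ (1 + ε) * (A ^ lam * B ^ (1 - lam)))
    (hε : ε ≤ min lam (1 - lam) * θ ^ 2) :
    A ^ lam * B ^ (1 - lam) ≤ ∫ r in Ioi 0, r ^ m * H r ∧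
    ∫ r in Ioi 0, r ^ m * |F r - A / (A ^ lam * B ^ (1 - lam)) * H r| ≤ transportConst m * θ * A ∧
    ∫ r in Ioi 0, r ^ m * |G r - B / (A ^ lam * B ^ (1 - lam)) * H r| ≤
      transportConst m * θ * B := by
  have hM := rpow_mul_rpow_one_sub_pos (lam := lam) hA hB
  set M := A ^ lam * B ^ (1 - lam) with hMd
  have hdiv : ∀ (K : ℝ → ℝ) (c : ℝ), ∫ r in Ioi 0, r ^ m * (K r / c) =
      (∫ r in Ioi 0, r ^ m * K r) / c := fun K c => by
    simp only [← mul_div_assoc, integral_div]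
  have hHM : IntegrableOn (fun r => r ^ m * (H r / M)) (Ioi 0) := by
    have : Integrable (fun r => r ^ m * H r / M) (volume.restrict (Ioi 0)) := hHi.div_const M
    simp only [mul_div_assoc] at this
    exact this
  obtain ⟨h1, h2, h3⟩ := transport_stability_of_integral_eq_one (m := m) (H := fun r => H r / M)
    hl0 hl1 hθ hθ1 (hF.div_const hA) (hG.div_const hB)
    (by rw [hdiv, hFA, div_self hA.ne']) (by rw [hdiv, hGB, div_self hB.ne'])
    (fun ρ hρ => div_nonneg (hH0 ρ hρ) hM.le)
    (fun x hx y hy hxy => div_le_div_of_nonneg_right (hHa hx hy hxy) hM.le)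
    hHM
    (fun r hr s hs => by
      rw [Real.div_rpow (hF.pos r hr).le hA.le, Real.div_rpow (hG.pos s hs).le hB.le,
        div_mul_div_comm]
      exact div_le_div_of_nonneg_right (hPL r hr s hs) hM.le)
    (by
      rw [hdiv, div_le_iff₀ hM]
      exact hle.trans (mul_le_mul_of_nonneg_right (by linarith) hM.le))
  have key : ∀ (K : ℝ → ℝ) (c : ℝ), 0 < c →
      ∫ r in Ioi 0, r ^ m * |K r - c / M * H r| = c * ∫ r in Ioi 0, r ^ m * |K r / c - H r / M| :=
    fun K c hc => by
      rw [← integral_const_mul]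
      congr 1; ext r
      rw [show K r - c / M * H r = c * (K r / c - H r / M) by field_simp, abs_mul, abs_of_pos hc]
      ring
  refine ⟨?_, ?_, ?_⟩
  · rwa [hdiv, one_le_div hM] at h1
  · rw [key F A hA]
    nlinarith
  · rw [key G B hB]
    nlinarith

/-! ### Log-concave profiles -/

/-- The profile on `[0, ∞)` of a radial log-concave function. -/
structure IsLogConcaveProfile (F : ℝ → ℝ) : Prop where
  nonneg : ∀ r, 0 ≤ r → 0 ≤ F r
  antitoneOn : AntitoneOn F (Set.Ici 0)
  logConcave : ∀ r s t, 0 ≤ r → 0 ≤ s → 0 < t → t < 1 →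
    F r ^ t * F s ^ (1 - t) ≤ F (t * r + (1 - t) * s)

lemma IsLogConcaveProfile.const_mul {F : ℝ → ℝ} (h : IsLogConcaveProfile F) {c : ℝ} (hc : 0 < c) :
    IsLogConcaveProfile fun r => c * F r where
  nonneg r hr := mul_nonneg hc.le (h.nonneg r hr)
  antitoneOn x hx y hy hxy := mul_le_mul_of_nonneg_left (h.antitoneOn hx hy hxy) hc.le
  logConcave r s t hr hs ht ht1 := by
    rw [Real.mul_rpow hc.le (h.nonneg r hr), Real.mul_rpow hc.le (h.nonneg s hs),
      mul_mul_mul_comm, ← Real.rpow_add hc, add_sub_cancel, Real.rpow_one]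
    exact mul_le_mul_of_nonneg_left (h.logConcave r s t hr hs ht ht1) hc.le

-- On the interior of its support a log-concave profile is the exponential of a concave function,
-- hence continuous. Only the right endpoint of the support can be lost, a null set.
open Set in
lemma IsLogConcaveProfile.exists_isRegularDensity {m : ℕ} {F : ℝ → ℝ} (h : IsLogConcaveProfile F)
    (hi : IntegrableOn (fun r => r ^ m * F r) (Ioi 0)) :
    ∃ (F₁ : ℝ → ℝ) (U : Set ℝ), IsRegularDensity m F₁ U ∧
      (∀ᵐ r ∂(volume.restrict (Ioi 0)), F₁ r = F r) ∧ ∀ r ∈ U, F₁ r = F r := by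
  set U : Set ℝ := {r | 0 < r ∧ ∃ r', r < r' ∧ 0 < F r'} with hU
  have hUo : IsOpen U := by
    have : U = Ioi 0 ∩ ⋃ r' ∈ {r' | 0 < F r'}, Iio r' := by
      ext r; simp only [hU, mem_ofPred_eq, mem_inter_iff, mem_Ioi, mem_iUnion, mem_Iio, exists_prop]
      constructor
      · rintro ⟨h0, r', h1, h2⟩; exact ⟨h0, r', h2, h1⟩
      · rintro ⟨h0, r', h2, h1⟩; exact ⟨h0, r', h1, h2⟩
    rw [this]
    exact isOpen_Ioi.inter (isOpen_biUnion fun _ _ => isOpen_Iio)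
  have hpos : ∀ r ∈ U, 0 < F r := by
    rintro r ⟨h0, r', h1, h2⟩
    exact h2.trans_le (h.antitoneOn h0.le (h0.trans h1).le h1.le)
  have hlow : ∀ r ∈ U, ∀ s, 0 < s → s ≤ r → s ∈ U := by
    rintro r ⟨h0, r', h1, h2⟩ s hs hsr
    exact ⟨hs, r', hsr.trans_lt h1, h2⟩
  have hconv : Convex ℝ U := by
    refine (ordConnected_iff.2 fun x hx y hy _ z hz => ?_).convex
    exact hlow y hy z (hx.1.trans_le hz.1) hz.2
  have hlog : ConcaveOn ℝ U fun r => Real.log (F r) := by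
    refine concaveOn_iff_forall_pos.2 ⟨hconv, fun x hx y hy a b ha hb hab => ?_⟩
    have hb' : b = 1 - a := by linarith
    have h1 := h.logConcave x y a hx.1.le hy.1.le ha (by linarith)
    have hFx := hpos x hx
    have hFy := hpos y hy
    have h2 := Real.log_le_log (rpow_mul_rpow_one_sub_pos hFx hFy) h1
    rw [Real.log_mul (Real.rpow_pos_of_pos hFx _).ne' (Real.rpow_pos_of_pos hFy _).ne',
      Real.log_rpow hFx, Real.log_rpow hFy, ← hb'] at h2
    simpa [smul_eq_mul] using h2
  have hcont : ContinuousOn F U := by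
    refine (Real.continuous_exp.comp_continuousOn (hlog.continuousOn hUo)).congr fun r hr => ?_
    exact (Real.exp_log (hpos r hr)).symm
  have hae : ∀ᵐ r ∂(volume.restrict (Ioi 0)), U.indicator F r = F r := by
    rw [ae_restrict_iff' measurableSet_Ioi]
    have hsub : {r : ℝ | 0 < r ∧ r ∉ U ∧ F r ≠ 0}.Subsingleton := by
      rintro x ⟨hx0, hxU, hx⟩ y ⟨hy0, hyU, hy⟩
      by_contra hne
      rcases lt_or_gt_of_ne hne with hlt | hlt
      · exact hxU ⟨hx0, y, hlt, (h.nonneg y hy0.le).lt_of_ne' hy⟩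
      · exact hyU ⟨hy0, x, hlt, (h.nonneg x hx0.le).lt_of_ne' hx⟩
    filter_upwards [measure_eq_zero_iff_ae_notMem.1 (hsub.measure_zero volume)] with r hr hr0
    by_cases hrU : r ∈ U
    · exact indicator_of_mem hrU F
    · rw [indicator_of_notMem hrU]
      by_contra hne
      exact hr ⟨hr0, hrU, fun h => hne h.symm⟩
  refine ⟨U.indicator F, U, ⟨hUo, fun r hr => hr.1, hlow, ?_, ?_, ?_, ?_⟩, hae,
    fun r hr => indicator_of_mem hr F⟩
  · exact hcont.congr fun r hr => indicator_of_mem hr F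
  · intro r hr; rw [indicator_of_mem hr]; exact hpos r hr
  · intro r _ hr; exact indicator_of_notMem hr F
  · refine hi.congr ?_
    filter_upwards [hae] with r hr
    rw [hr]

open Set in
lemma profile_stability {m : ℕ} {lam ε θ A B : ℝ} {F G H : ℝ → ℝ}
    (hl0 : 0 < lam) (hl1 : lam < 1) (hθ : 0 < θ) (hθ1 : θ ≤ 1)
    (hF : IsLogConcaveProfile F) (hG : IsLogConcaveProfile G)
    (hFi : IntegrableOn (fun r => r ^ m * F r) (Ioi 0))
    (hGi : IntegrableOn (fun r => r ^ m * G r) (Ioi 0)) (hA : 0 < A) (hB : 0 < B)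
    (hFA : ∫ r in Ioi 0, r ^ m * F r = A) (hGB : ∫ r in Ioi 0, r ^ m * G r = B)
    (hH0 : ∀ ρ, 0 < ρ → 0 ≤ H ρ) (hHa : AntitoneOn H (Ioi 0))
    (hHi : IntegrableOn (fun r => r ^ m * H r) (Ioi 0))
    (hPL : ∀ r s, 0 ≤ r → 0 ≤ s → F r ^ lam * G s ^ (1 - lam) ≤ H (lam * r + (1 - lam) * s))
    (hle : ∫ r in Ioi 0, r ^ m * H r ≤ (1 + ε) * (A ^ lam * B ^ (1 - lam)))
    (hε : ε ≤ min lam (1 - lam) * θ ^ 2) :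
    A ^ lam * B ^ (1 - lam) ≤ ∫ r in Ioi 0, r ^ m * H r ∧
    ∫ r in Ioi 0, r ^ m * |F r - A / (A ^ lam * B ^ (1 - lam)) * H r| ≤ transportConst m * θ * A ∧
    ∫ r in Ioi 0, r ^ m * |G r - B / (A ^ lam * B ^ (1 - lam)) * H r| ≤
      transportConst m * θ * B := by
  obtain ⟨F₁, U, hF₁, hFae, hFU⟩ := hF.exists_isRegularDensity hFi
  obtain ⟨G₁, V, hG₁, hGae, hGV⟩ := hG.exists_isRegularDensity hGi
  have hFA' : ∫ r in Ioi 0, r ^ m * F₁ r = A := by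
    rw [← hFA]; exact integral_congr_ae (hFae.mono fun r hr => by simp only [hr])
  have hGB' : ∫ r in Ioi 0, r ^ m * G₁ r = B := by
    rw [← hGB]; exact integral_congr_ae (hGae.mono fun r hr => by simp only [hr])
  obtain ⟨h1, h2, h3⟩ := transport_stability hl0 hl1 hθ hθ1 hF₁ hG₁ hA hB hFA' hGB' hH0 hHa hHi
    (fun r hr s hs => by
      rw [hFU r hr, hGV s hs]
      exact hPL r s (le_of_lt (hF₁.subset hr)) (le_of_lt (hG₁.subset hs))) hle hε
  refine ⟨h1, ?_, ?_⟩
  · exact (integral_congr_ae (hFae.mono fun r hr => by simp only [hr])).symm.trans_le h2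
  · exact (integral_congr_ae (hGae.mono fun r hr => by simp only [hr])).symm.trans_le h3

/-! ### Extremal admissible functions -/

/-- The largest function `F` with `F r ^ l * G s ^ (1 - l) ≤ H (l * r + (1 - l) * s)`. -/
noncomputable def upperEnvelope (l : ℝ) (H G : ℝ → ℝ) (r : ℝ) : ℝ :=
  ⨅ s : {s : ℝ // 0 ≤ s ∧ 0 < G s}, (H (l * r + (1 - l) * s) / G s ^ (1 - l)) ^ (1 / l)

section UpperEnvelope

variable {l : ℝ} {F G H : ℝ → ℝ} {m : ℕ}

lemma upperEnvelope_bddBelow (hH : ∀ r, 0 ≤ r → 0 ≤ H r) (hl0 : 0 < l) (hl1 : l < 1) {r : ℝ}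
    (hr : 0 ≤ r) : BddBelow (Set.range fun s : {s : ℝ // 0 ≤ s ∧ 0 < G s} =>
      (H (l * r + (1 - l) * s) / G s ^ (1 - l)) ^ (1 / l)) := by
  refine ⟨0, ?_⟩
  rintro _ ⟨⟨s, hs, hGs⟩, rfl⟩
  have := hH (l * r + (1 - l) * s) (by nlinarith)
  dsimp only
  positivity

lemma upperEnvelope_le (hH : ∀ r, 0 ≤ r → 0 ≤ H r) (hl0 : 0 < l) (hl1 : l < 1) {r s : ℝ}
    (hr : 0 ≤ r) (hs : 0 ≤ s) (hGs : 0 < G s) :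
    upperEnvelope l H G r ≤ (H (l * r + (1 - l) * s) / G s ^ (1 - l)) ^ (1 / l) :=
  ciInf_le (upperEnvelope_bddBelow hH hl0 hl1 hr) (⟨s, hs, hGs⟩ : {s : ℝ // 0 ≤ s ∧ 0 < G s})

lemma upperEnvelope_nonneg (hH : ∀ r, 0 ≤ r → 0 ≤ H r) (hl0 : 0 < l) (hl1 : l < 1) {r : ℝ}
    (hr : 0 ≤ r) : 0 ≤ upperEnvelope l H G r := by
  refine Real.iInf_nonneg ?_
  rintro ⟨s, hs, hGs⟩
  have := hH (l * r + (1 - l) * s) (by nlinarith)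
  dsimp only
  positivity

lemma le_upperEnvelope (hl0 : 0 < l) (hG : ∃ s, 0 ≤ s ∧ 0 < G s) {r : ℝ}
    (hF : 0 ≤ F r) (hPL : ∀ s, 0 ≤ s → F r ^ l * G s ^ (1 - l) ≤ H (l * r + (1 - l) * s)) :
    F r ≤ upperEnvelope l H G r := by
  obtain ⟨s₀, hs₀⟩ := hG
  have : Nonempty {s : ℝ // 0 ≤ s ∧ 0 < G s} := ⟨⟨s₀, hs₀⟩⟩
  refine le_ciInf ?_
  rintro ⟨s, hs, hGs⟩
  have h1 : F r ^ l ≤ H (l * r + (1 - l) * s) / G s ^ (1 - l) :=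
    (le_div_iff₀ (Real.rpow_pos_of_pos hGs _)).2 (hPL s hs)
  calc F r = (F r ^ l) ^ (1 / l) := by
        rw [← Real.rpow_mul hF, mul_one_div_cancel hl0.ne', Real.rpow_one]
    _ ≤ _ := Real.rpow_le_rpow (Real.rpow_nonneg hF _) h1 (by positivity)

lemma upperEnvelope_mul_le (hH : ∀ r, 0 ≤ r → 0 ≤ H r) (hG : ∀ s, 0 ≤ s → 0 ≤ G s)
    (hl0 : 0 < l) (hl1 : l < 1) {r s : ℝ} (hr : 0 ≤ r) (hs : 0 ≤ s) :
    upperEnvelope l H G r ^ l * G s ^ (1 - l) ≤ H (l * r + (1 - l) * s) := by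
  have hHz := hH (l * r + (1 - l) * s) (by nlinarith)
  rcases (hG s hs).eq_or_lt with h | h
  · rw [← h, Real.zero_rpow (by linarith), mul_zero]; exact hHz
  · have hp := Real.rpow_pos_of_pos h (1 - l)
    rw [← le_div_iff₀ hp]
    calc upperEnvelope l H G r ^ l
        ≤ ((H (l * r + (1 - l) * s) / G s ^ (1 - l)) ^ (1 / l)) ^ l :=
          Real.rpow_le_rpow (upperEnvelope_nonneg hH hl0 hl1 hr)
            (upperEnvelope_le hH hl0 hl1 hr hs h) hl0.le
      _ = _ := by
          rw [← Real.rpow_mul (by positivity), one_div_mul_cancel hl0.ne', Real.rpow_one]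

/-- For each fixed `s` the expression is a positive power of a multiple of a translated and rescaled
`H`. Monotonicity and log-concavity pass to the infimum. -/
lemma upperEnvelope_isLogConcaveProfile (hH : IsLogConcaveProfile H) (hl0 : 0 < l) (hl1 : l < 1)
    (hG : ∃ s, 0 ≤ s ∧ 0 < G s) : IsLogConcaveProfile (upperEnvelope l H G) where
  nonneg r hr := upperEnvelope_nonneg hH.nonneg hl0 hl1 hr
  antitoneOn := by
    intro r₁ h₁ r₂ h₂ h
    have h₁' : 0 ≤ r₁ := h₁
    have h₂' : 0 ≤ r₂ := h₂
    refine ciInf_mono (upperEnvelope_bddBelow hH.nonneg hl0 hl1 h₂) ?_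
    rintro ⟨s, hs, hGs⟩
    have h3 : 0 ≤ (1 - l) * s := mul_nonneg (by linarith) hs
    have h4 : 0 ≤ l * r₁ + (1 - l) * s := by positivity
    have h5 : 0 ≤ l * r₂ + (1 - l) * s := by positivity
    have h6 : H (l * r₂ + (1 - l) * s) ≤ H (l * r₁ + (1 - l) * s) :=
      hH.antitoneOn h4 h5 (by gcongr)
    have h7 := hH.nonneg _ h5
    dsimp only
    gcongr
  logConcave r₁ r₂ t hr₁ hr₂ ht ht1 := by
    obtain ⟨s₀, hs₀⟩ := hG
    have : Nonempty {s : ℝ // 0 ≤ s ∧ 0 < G s} := ⟨⟨s₀, hs₀⟩⟩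
    refine le_ciInf ?_
    rintro ⟨s, hs, hGs⟩
    have h3 : 0 ≤ (1 - l) * s := mul_nonneg (by linarith) hs
    have h4 : 0 ≤ l * r₁ + (1 - l) * s := by positivity
    have h5 : 0 ≤ l * r₂ + (1 - l) * s := by positivity
    have hp := Real.rpow_pos_of_pos hGs (1 - l)
    have h7 := hH.nonneg _ h4
    have h8 := hH.nonneg _ h5
    have h9 : t * (l * r₁ + (1 - l) * s) + (1 - t) * (l * r₂ + (1 - l) * s) =
      l * (t * r₁ + (1 - t) * r₂) + (1 - l) * s := by ring
    have h10 := ((hH.const_mul (inv_pos.2 hp)).logConcave _ _ t h4 h5 ht ht1)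
    rw [h9] at h10
    simp only [inv_mul_eq_div] at h10
    dsimp only
    have ha : 0 ≤ H (l * r₁ + (1 - l) * s) / G s ^ (1 - l) := by positivity
    have hb : 0 ≤ H (l * r₂ + (1 - l) * s) / G s ^ (1 - l) := by positivity
    calc upperEnvelope l H G r₁ ^ t * upperEnvelope l H G r₂ ^ (1 - t)
        ≤ ((H (l * r₁ + (1 - l) * s) / G s ^ (1 - l)) ^ (1 / l)) ^ t *
          ((H (l * r₂ + (1 - l) * s) / G s ^ (1 - l)) ^ (1 / l)) ^ (1 - t) := by
          have e1 := upperEnvelope_le hH.nonneg hl0 hl1 hr₁ hs hGs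
          have e2 := upperEnvelope_le hH.nonneg hl0 hl1 hr₂ hs hGs
          have e3 := upperEnvelope_nonneg (G := G) hH.nonneg hl0 hl1 hr₁
          have e4 := upperEnvelope_nonneg (G := G) hH.nonneg hl0 hl1 hr₂
          have e5 : 0 ≤ 1 - t := by linarith
          gcongr
      _ = ((H (l * r₁ + (1 - l) * s) / G s ^ (1 - l)) ^ t *
          (H (l * r₂ + (1 - l) * s) / G s ^ (1 - l)) ^ (1 - t)) ^ (1 / l) := by
          rw [Real.mul_rpow (by positivity) (by positivity), ← Real.rpow_mul ha,
            ← Real.rpow_mul ha, ← Real.rpow_mul hb, ← Real.rpow_mul hb, mul_comm t,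
            mul_comm (1 - t)]
      _ ≤ _ := by gcongr

-- One value `s` with `G s > 0` suffices. Since `1 / l > 1` and `H ≤ H 0`, the envelope is dominated
-- by a constant times `H (l r)`.
open Set in
lemma upperEnvelope_integrableOn (hH : IsLogConcaveProfile H) (hl0 : 0 < l) (hl1 : l < 1)
    (hG : ∃ s, 0 ≤ s ∧ 0 < G s) (hHi : IntegrableOn (fun r => r ^ m * H r) (Ioi 0)) :
    IntegrableOn (fun r => r ^ m * upperEnvelope l H G r) (Ioi 0) := by
  have hprof := upperEnvelope_isLogConcaveProfile hH hl0 hl1 hG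
  obtain ⟨s, hs, hGs⟩ := hG
  have hp := Real.rpow_pos_of_pos hGs (1 - l)
  set K := H 0 ^ (1 / l - 1) / (G s ^ (1 - l)) ^ (1 / l) with hK
  have hdom : IntegrableOn (fun r => K / l ^ m * ((l * r) ^ m * H (l * r))) (Ioi 0) := by
    have h := (integrableOn_Ioi_comp_mul_left_iff (fun r => r ^ m * H r) 0 hl0).2 (by simpa using hHi)
    exact h.const_mul (K / l ^ m)
  refine Integrable.mono' hdom ?_ ?_
  · refine (AEStronglyMeasurable.mul (by fun_prop) ?_)
    exact (aemeasurable_restrict_of_antitoneOn measurableSet_Ioi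
      (hprof.antitoneOn.mono Ioi_subset_Ici_self)).aestronglyMeasurable
  · filter_upwards [ae_restrict_mem measurableSet_Ioi] with r hr
    have hr0 : 0 < r := hr
    have hlr : 0 ≤ l * r := by positivity
    have h3 : 0 ≤ (1 - l) * s := mul_nonneg (by linarith) hs
    have h4 : 0 ≤ l * r + (1 - l) * s := by positivity
    have hle : H (l * r + (1 - l) * s) ≤ H (l * r) := hH.antitoneOn hlr h4 (by linarith)
    have hle0 : H (l * r) ≤ H 0 := hH.antitoneOn (le_refl (0 : ℝ)) hlr hlr
    have h5 := hH.nonneg _ h4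
    have h6 := hH.nonneg _ hlr
    have hl' : 0 ≤ 1 / l - 1 := by rw [sub_nonneg, one_le_div hl0]; exact hl1.le
    have h7 : upperEnvelope l H G r ≤ K * H (l * r) := by
      calc upperEnvelope l H G r ≤ (H (l * r + (1 - l) * s) / G s ^ (1 - l)) ^ (1 / l) :=
            upperEnvelope_le hH.nonneg hl0 hl1 hr0.le hs hGs
        _ = H (l * r + (1 - l) * s) ^ (1 / l) / (G s ^ (1 - l)) ^ (1 / l) :=
            Real.div_rpow h5 hp.le _
        _ ≤ H (l * r) ^ (1 / l) / (G s ^ (1 - l)) ^ (1 / l) := by gcongr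
        _ = H (l * r) ^ (1 / l - 1) * H (l * r) / (G s ^ (1 - l)) ^ (1 / l) := by
            congr 1
            nth_rewrite 3 [← Real.rpow_one (H (l * r))]
            rw [← Real.rpow_add_of_nonneg h6 hl' zero_le_one, sub_add_cancel]
        _ ≤ H 0 ^ (1 / l - 1) * H (l * r) / (G s ^ (1 - l)) ^ (1 / l) := by gcongr
        _ = _ := by rw [hK]; ring
    have h8 := hprof.nonneg r hr0.le
    rw [Real.norm_of_nonneg (by positivity)]
    calc r ^ m * upperEnvelope l H G r ≤ r ^ m * (K * H (l * r)) := by gcongr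
      _ = _ := by rw [mul_pow]; field_simp

end UpperEnvelope

/-- The smallest non-increasing function `H` with
`F r ^ l * G s ^ (1 - l) ≤ H (l * r + (1 - l) * s)`. -/
noncomputable def lowerEnvelope (l : ℝ) (F G : ℝ → ℝ) (q : ℝ) : ℝ :=
  ⨆ p : {p : ℝ × ℝ // 0 ≤ p.1 ∧ 0 ≤ p.2 ∧ q ≤ l * p.1 + (1 - l) * p.2},
    F p.1.1 ^ l * G p.1.2 ^ (1 - l)

section LowerEnvelope

variable {l : ℝ} {F G H : ℝ → ℝ} {m : ℕ}

lemma lowerEnvelope_bddAbove (hF : IsLogConcaveProfile F) (hG : IsLogConcaveProfile G)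
    (hl0 : 0 < l) (hl1 : l < 1) (q : ℝ) :
    BddAbove (Set.range
      fun p : {p : ℝ × ℝ // 0 ≤ p.1 ∧ 0 ≤ p.2 ∧ q ≤ l * p.1 + (1 - l) * p.2} =>
        F p.1.1 ^ l * G p.1.2 ^ (1 - l)) := by
  refine ⟨F 0 ^ l * G 0 ^ (1 - l), ?_⟩
  rintro _ ⟨⟨⟨r, s⟩, hr, hs, -⟩, rfl⟩
  dsimp only at hr hs ⊢
  have h1 := hF.nonneg r hr
  have h2 := hG.nonneg s hs
  have h3 := hF.antitoneOn (le_refl (0 : ℝ)) hr hr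
  have h4 := hG.antitoneOn (le_refl (0 : ℝ)) hs hs
  have h6 := h1.trans h3
  have h5 : 0 ≤ 1 - l := by linarith
  gcongr

lemma le_lowerEnvelope (hF : IsLogConcaveProfile F) (hG : IsLogConcaveProfile G)
    (hl0 : 0 < l) (hl1 : l < 1) {q r s : ℝ} (hr : 0 ≤ r) (hs : 0 ≤ s)
    (hq : q ≤ l * r + (1 - l) * s) :
    F r ^ l * G s ^ (1 - l) ≤ lowerEnvelope l F G q :=
  le_ciSup (lowerEnvelope_bddAbove hF hG hl0 hl1 q)
    (⟨(r, s), hr, hs, hq⟩ : {p : ℝ × ℝ // 0 ≤ p.1 ∧ 0 ≤ p.2 ∧ q ≤ l * p.1 + (1 - l) * p.2})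

lemma lowerEnvelope_nonneg (hF : IsLogConcaveProfile F) (hG : IsLogConcaveProfile G) (q : ℝ) :
    0 ≤ lowerEnvelope l F G q := by
  refine Real.iSup_nonneg ?_
  rintro ⟨⟨r, s⟩, hr, hs, -⟩
  exact mul_nonneg (Real.rpow_nonneg (hF.nonneg r hr) _) (Real.rpow_nonneg (hG.nonneg s hs) _)

lemma lowerEnvelope_antitone (hF : IsLogConcaveProfile F) (hG : IsLogConcaveProfile G)
    (hl0 : 0 < l) (hl1 : l < 1) : Antitone (lowerEnvelope l F G) := by
  intro q q' h
  refine Real.iSup_le ?_ (lowerEnvelope_nonneg hF hG q)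
  rintro ⟨⟨r, s⟩, hr, hs, hq⟩
  exact le_lowerEnvelope hF hG hl0 hl1 hr hs (h.trans hq)

/-- An admissible pair whose combination exceeds `q` can be shrunk by a common factor until it
equals `q`; this only increases `F` and `G`. Hence a non-monotone `H` still dominates the envelope
on the open half-line. -/
lemma lowerEnvelope_le (hF : IsLogConcaveProfile F) (hG : IsLogConcaveProfile G)
    (hl0 : 0 < l) (hl1 : l < 1)
    (hPL : ∀ r s, 0 ≤ r → 0 ≤ s → F r ^ l * G s ^ (1 - l) ≤ H (l * r + (1 - l) * s))
    {q : ℝ} (hq : 0 < q) (hHq : 0 ≤ H q) : lowerEnvelope l F G q ≤ H q := by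
  refine Real.iSup_le ?_ hHq
  rintro ⟨⟨r, s⟩, hr, hs, hqrs⟩
  dsimp only at hr hs hqrs ⊢
  have hD : 0 < l * r + (1 - l) * s := hq.trans_le hqrs
  set c := q / (l * r + (1 - l) * s) with hc
  have hc0 : 0 ≤ c := by positivity
  have hc1 : c ≤ 1 := (div_le_one hD).2 hqrs
  have h1 : F r ≤ F (c * r) := hF.antitoneOn (mul_nonneg hc0 hr) hr (by nlinarith)
  have h2 : G s ≤ G (c * s) := hG.antitoneOn (mul_nonneg hc0 hs) hs (by nlinarith)
  have h3 := hPL (c * r) (c * s) (mul_nonneg hc0 hr) (mul_nonneg hc0 hs)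
  have h4 : l * (c * r) + (1 - l) * (c * s) = q := by
    rw [show l * (c * r) + (1 - l) * (c * s) = c * (l * r + (1 - l) * s) by ring, hc,
      div_mul_cancel₀ _ hD.ne']
  rw [h4] at h3
  refine le_trans ?_ h3
  have h5 := hF.nonneg r hr
  have h6 := hG.nonneg s hs
  have h7 : 0 ≤ 1 - l := by linarith
  have h8 := h5.trans h1
  gcongr

end LowerEnvelope

/-! ### Stability of profiles under either log-concavity hypothesis -/

lemma transportConst_nonneg (m : ℕ) : 0 ≤ transportConst m := by
  have := le_pointwiseConst m
  unfold transportConst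
  positivity

lemma integrableOn_pow_mul_abs_sub {m : ℕ} {F H : ℝ → ℝ} {S : Set ℝ} (hS : S ⊆ Set.Ioi 0)
    (hSm : MeasurableSet S) (hF : IntegrableOn (fun r => r ^ m * F r) S)
    (hH : IntegrableOn (fun r => r ^ m * H r) S) (c : ℝ) :
    IntegrableOn (fun r => r ^ m * |F r - c * H r|) S := by
  refine ((hF.sub (hH.const_mul c)).abs).congr ?_
  filter_upwards [ae_restrict_mem hSm] with r hr
  have h1 : 0 ≤ r ^ m := pow_nonneg (le_of_lt (hS hr)) m
  simp only [Pi.sub_apply]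
  rw [show r ^ m * F r - c * (r ^ m * H r) = r ^ m * (F r - c * H r) by ring, abs_mul,
    abs_of_nonneg h1]

/-- Since `B ≤ B'`, the factor `(A' / A) ^ l` is at most `1 + ε`, so `log (A' / A) ≤ ε / l ≤ θ ^ 2`.
This limits the mass gained by passing to an envelope. -/
lemma le_one_add_mul_of_rpow_le {A A' B B' l ε θ : ℝ} (hl0 : 0 < l) (hl1 : l < 1) (hA : 0 < A)
    (hAA : A ≤ A') (hB : 0 < B) (hBB : B ≤ B') (hθ : 0 < θ) (hθ1 : θ ≤ 1)
    (hε0 : 0 ≤ ε) (hε : ε ≤ l * θ ^ 2)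
    (h : A' ^ l * B' ^ (1 - l) ≤ (1 + ε) * (A ^ l * B ^ (1 - l))) : A' ≤ (1 + 2 * θ) * A := by
  have hA' : 0 < A' := hA.trans_le hAA
  have hk : 0 < A' / A := by positivity
  have hBp := Real.rpow_pos_of_pos hB (1 - l)
  have h1 : A' ^ l ≤ (1 + ε) * A ^ l := by
    have h2 : A' ^ l * B ^ (1 - l) ≤ A' ^ l * B' ^ (1 - l) := by
      have : 0 ≤ 1 - l := by linarith
      gcongr
    have h3 : A' ^ l * B ^ (1 - l) ≤ ((1 + ε) * A ^ l) * B ^ (1 - l) := by linarith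
    exact le_of_mul_le_mul_right h3 hBp
  have h2 : (A' / A) ^ l ≤ 1 + ε := by
    rw [Real.div_rpow hA'.le hA.le, div_le_iff₀ (Real.rpow_pos_of_pos hA l)]
    exact h1
  have h3 : l * Real.log (A' / A) ≤ ε := by
    rw [← Real.log_rpow hk]
    have := Real.log_le_log (Real.rpow_pos_of_pos hk l) h2
    have := Real.log_le_sub_one_of_pos (show 0 < 1 + ε by linarith)
    linarith
  have h4 : Real.log (A' / A) ≤ θ ^ 2 := by
    by_contra! hc
    nlinarith
  have h5 : θ ^ 2 ≤ θ := by nlinarith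
  have h6 : A' / A ≤ 1 + 2 * θ := by
    rw [← Real.exp_log hk]
    have h7 := Real.abs_exp_sub_one_le (x := θ) (by rw [abs_of_pos hθ]; exact hθ1)
    rw [abs_of_pos hθ] at h7
    have h8 := Real.exp_le_exp.2 (h4.trans h5)
    linarith [le_abs_self (Real.exp θ - 1)]
  rwa [div_le_iff₀ hA] at h6

-- Undoes the passage to an envelope: the triangle inequality costs the gained mass `A' - A` and the
-- change of the coefficient of `H`, both of order `θ`.
open Set in
lemma stability_of_le {m : ℕ} {F F' H : ℝ → ℝ} {A A' M M' ε θ C : ℝ}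
    (hFi : IntegrableOn (fun r => r ^ m * F r) (Ioi 0))
    (hFi' : IntegrableOn (fun r => r ^ m * F' r) (Ioi 0))
    (hHi : IntegrableOn (fun r => r ^ m * H r) (Ioi 0)) (hH0 : ∀ r, 0 < r → 0 ≤ H r)
    (hFF : ∀ r, 0 < r → F r ≤ F' r)
    (hA : 0 < A) (hFA : ∫ r in Ioi 0, r ^ m * F r = A) (hFA' : ∫ r in Ioi 0, r ^ m * F' r = A')
    (hAA : A' ≤ (1 + 2 * θ) * A) (hA1 : A ≤ A') (hM : 0 < M) (hMM : M ≤ M')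
    (hMM' : M' ≤ (1 + ε) * M)
    (hle : ∫ r in Ioi 0, r ^ m * H r ≤ (1 + ε) * M) (hθ : 0 < θ) (hθ1 : θ ≤ 1)
    (hεθ : ε ≤ θ) (hC : 0 ≤ C)
    (h : ∫ r in Ioi 0, r ^ m * |F' r - A' / M' * H r| ≤ C * θ * A') :
    ∫ r in Ioi 0, r ^ m * |F r - A / M * H r| ≤ (3 * C + 6) * θ * A := by
  have hM' : 0 < M' := hM.trans_le hMM
  have hi1 := integrableOn_pow_mul_abs_sub subset_rfl measurableSet_Ioi hFi hHi (A / M)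
  have hi2 := integrableOn_pow_mul_abs_sub subset_rfl measurableSet_Ioi hFi' hHi (A' / M')
  have hcoef : |A' / M' - A / M| ≤ 2 * θ * (A / M) := by
    rw [abs_le]
    constructor
    · have h1 : A / M * (1 - ε) ≤ A' / M' := by
        rw [div_mul_eq_mul_div, div_le_div_iff₀ hM hM']
        calc A * (1 - ε) * M' ≤ A * (1 - ε) * ((1 + ε) * M) := by
              have : 0 ≤ 1 - ε := by linarith
              gcongr
          _ = A * M * (1 - ε ^ 2) := by ring
          _ ≤ A * M := by nlinarith [mul_pos hA hM, sq_nonneg ε]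
          _ ≤ A' * M := by gcongr
      have h2 : 0 < A / M := by positivity
      nlinarith
    · have h1 : A' / M' ≤ (1 + 2 * θ) * A / M := by gcongr
      have h2 : (1 + 2 * θ) * A / M = A / M + 2 * θ * (A / M) := by ring
      linarith
  have hHint0 : 0 ≤ ∫ r in Ioi 0, r ^ m * H r :=
    setIntegral_nonneg measurableSet_Ioi fun r hr =>
      mul_nonneg (pow_nonneg (le_of_lt hr) m) (hH0 r hr)
  have hmain : ∫ r in Ioi 0, r ^ m * |F r - A / M * H r| ≤
      ∫ r in Ioi 0, ((r ^ m * F' r - r ^ m * F r) + r ^ m * |F' r - A' / M' * H r| +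
        |A' / M' - A / M| * (r ^ m * H r)) := by
    refine setIntegral_mono_on hi1 (((hFi'.sub hFi).add hi2).add (hHi.const_mul _))
      measurableSet_Ioi fun r hr => ?_
    have h1 : 0 ≤ r ^ m := pow_nonneg (le_of_lt hr) m
    have h2 := hFF r hr
    have h3 : |F r - A / M * H r| ≤
        (F' r - F r) + |F' r - A' / M' * H r| + |A' / M' - A / M| * H r := by
      calc |F r - A / M * H r| = |(F r - F' r) + (F' r - A' / M' * H r) +
            (A' / M' - A / M) * H r| := by ring_nf
        _ ≤ |F r - F' r| + |F' r - A' / M' * H r| + |(A' / M' - A / M) * H r| :=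
            abs_add_three _ _ _
        _ = _ := by
            rw [abs_mul, abs_of_nonneg (hH0 r hr), abs_of_nonpos (by linarith : F r - F' r ≤ 0)]
            ring
    calc r ^ m * |F r - A / M * H r| ≤ r ^ m *
          ((F' r - F r) + |F' r - A' / M' * H r| + |A' / M' - A / M| * H r) := by gcongr
      _ = _ := by ring
  rw [integral_add (f := fun r => (r ^ m * F' r - r ^ m * F r) + r ^ m * |F' r - A' / M' * H r|)
      ((hFi'.sub hFi).add hi2) (hHi.const_mul _),
    integral_add (f := fun r => r ^ m * F' r - r ^ m * F r) (hFi'.sub hFi) hi2,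
    integral_sub hFi' hFi, integral_const_mul, hFA, hFA'] at hmain
  have h5 : |A' / M' - A / M| * ∫ r in Ioi 0, r ^ m * H r ≤ 2 * θ * (A / M) * (2 * M) := by
    gcongr
    nlinarith
  have h6 : 2 * θ * (A / M) * (2 * M) = 4 * θ * A := by field_simp; ring
  have h7 : C * θ * A' ≤ C * θ * (3 * A) := by
    have : A' ≤ 3 * A := by nlinarith
    gcongr
  linarith

open Set in
lemma profile_stability_of_right {m : ℕ} {lam ε θ A B : ℝ} {F G H : ℝ → ℝ}
    (hl0 : 0 < lam) (hl1 : lam < 1) (hθ : 0 < θ) (hθ1 : θ ≤ 1) (hε0 : 0 ≤ ε)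
    (hF0 : ∀ r, 0 ≤ r → 0 ≤ F r) (hG0 : ∀ r, 0 ≤ r → 0 ≤ G r) (hH : IsLogConcaveProfile H)
    (hFi : IntegrableOn (fun r => r ^ m * F r) (Ioi 0))
    (hGi : IntegrableOn (fun r => r ^ m * G r) (Ioi 0))
    (hHi : IntegrableOn (fun r => r ^ m * H r) (Ioi 0)) (hA : 0 < A) (hB : 0 < B)
    (hFA : ∫ r in Ioi 0, r ^ m * F r = A) (hGB : ∫ r in Ioi 0, r ^ m * G r = B)
    (hPL : ∀ r s, 0 ≤ r → 0 ≤ s → F r ^ lam * G s ^ (1 - lam) ≤ H (lam * r + (1 - lam) * s))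
    (hle : ∫ r in Ioi 0, r ^ m * H r ≤ (1 + ε) * (A ^ lam * B ^ (1 - lam)))
    (hε : ε ≤ min lam (1 - lam) * θ ^ 2) :
    ∫ r in Ioi 0, r ^ m * |F r - A / (A ^ lam * B ^ (1 - lam)) * H r| ≤
      (3 * transportConst m + 6) * θ * A ∧
    ∫ r in Ioi 0, r ^ m * |G r - B / (A ^ lam * B ^ (1 - lam)) * H r| ≤
      (3 * transportConst m + 6) * θ * B := by
  have hex : ∀ {K : ℝ → ℝ} {c : ℝ}, 0 < c → ∫ r in Ioi 0, r ^ m * K r = c →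
      ∃ s, 0 ≤ s ∧ 0 < K s := fun {K c} hc hK => by
    by_contra! hn
    have : ∫ r in Ioi 0, r ^ m * K r ≤ 0 := setIntegral_nonpos measurableSet_Ioi fun r hr =>
      mul_nonpos_of_nonneg_of_nonpos (pow_nonneg (le_of_lt hr) m) (hn r (le_of_lt hr))
    linarith
  have hGex := hex hB hGB
  set F' := upperEnvelope lam H G with hF'
  have hFF : ∀ r, 0 ≤ r → F r ≤ F' r := fun r hr =>
    le_upperEnvelope hl0 hGex (hF0 r hr) fun s hs => hPL r s hr hs
  have hF'prof : IsLogConcaveProfile F' := upperEnvelope_isLogConcaveProfile hH hl0 hl1 hGex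
  have hF'i := upperEnvelope_integrableOn (m := m) hH hl0 hl1 hGex hHi
  have hPL' : ∀ r s, 0 ≤ r → 0 ≤ s → F' r ^ lam * G s ^ (1 - lam) ≤ H (lam * r + (1 - lam) * s) :=
    fun r s hr hs => upperEnvelope_mul_le hH.nonneg hG0 hl0 hl1 hr hs
  have hF'ex : ∃ s, 0 ≤ s ∧ 0 < F' s := by
    obtain ⟨s, hs, hFs⟩ := hex hA hFA
    exact ⟨s, hs, hFs.trans_le (hFF s hs)⟩
  have hl0' : 0 < 1 - lam := by linarith
  have hl1' : 1 - lam < 1 := by linarith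
  -- The second envelope is taken against `F'` rather than `F`, so that the pair of envelopes still
  -- satisfies the hypothesis with the same `H`.
  set G' := upperEnvelope (1 - lam) H F' with hG'
  have hGG : ∀ r, 0 ≤ r → G r ≤ G' r := fun s hs =>
    le_upperEnvelope hl0' hF'ex (hG0 s hs) fun r hr => by
      have := hPL' r s hr hs
      rwa [sub_sub_cancel, mul_comm, add_comm]
  have hG'prof : IsLogConcaveProfile G' := upperEnvelope_isLogConcaveProfile hH hl0' hl1' hF'ex
  have hG'i := upperEnvelope_integrableOn (m := m) hH hl0' hl1' hF'ex hHi
  have hPL'' : ∀ r s, 0 ≤ r → 0 ≤ s →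
      F' r ^ lam * G' s ^ (1 - lam) ≤ H (lam * r + (1 - lam) * s) := fun r s hr hs => by
    have := upperEnvelope_mul_le hH.nonneg hF'prof.nonneg hl0' hl1' hs hr
    rwa [sub_sub_cancel, mul_comm, add_comm] at this
  have hmono : ∀ {K K' : ℝ → ℝ}, IntegrableOn (fun r => r ^ m * K r) (Ioi 0) →
      IntegrableOn (fun r => r ^ m * K' r) (Ioi 0) → (∀ r, 0 ≤ r → K r ≤ K' r) →
      ∫ r in Ioi 0, r ^ m * K r ≤ ∫ r in Ioi 0, r ^ m * K' r := fun hK hK' h =>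
    setIntegral_mono_on hK hK' measurableSet_Ioi fun r hr =>
      mul_le_mul_of_nonneg_left (h r (le_of_lt hr)) (pow_nonneg (le_of_lt hr) m)
  have hAA : A ≤ ∫ r in Ioi 0, r ^ m * F' r := hFA ▸ hmono hFi hF'i hFF
  have hBB : B ≤ ∫ r in Ioi 0, r ^ m * G' r := hGB ▸ hmono hGi hG'i hGG
  obtain ⟨A', hA'⟩ : ∃ A', A' = ∫ r in Ioi 0, r ^ m * F' r := ⟨_, rfl⟩
  obtain ⟨B', hB'⟩ : ∃ B', B' = ∫ r in Ioi 0, r ^ m * G' r := ⟨_, rfl⟩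
  rw [← hA'] at hAA
  rw [← hB'] at hBB
  have hM := rpow_mul_rpow_one_sub_pos (lam := lam) hA hB
  have hMM : A ^ lam * B ^ (1 - lam) ≤ A' ^ lam * B' ^ (1 - lam) := by
    have := hA.le.trans hAA
    gcongr
  obtain ⟨h1, h2, h3⟩ := profile_stability hl0 hl1 hθ hθ1 hF'prof hG'prof hF'i hG'i
    (hA.trans_le hAA) (hB.trans_le hBB) hA'.symm hB'.symm (fun ρ hρ => hH.nonneg ρ hρ.le)
    (hH.antitoneOn.mono Ioi_subset_Ici_self) hHi hPL''
    (hle.trans (mul_le_mul_of_nonneg_left hMM (by linarith))) hε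
  have hθ2 : 0 ≤ θ ^ 2 := sq_nonneg θ
  have hε1 : ε ≤ lam * θ ^ 2 := hε.trans (mul_le_mul_of_nonneg_right (min_le_left _ _) hθ2)
  have hε2 : ε ≤ (1 - lam) * θ ^ 2 := hε.trans (mul_le_mul_of_nonneg_right (min_le_right _ _) hθ2)
  have hεθ : ε ≤ θ := by nlinarith
  have hA3 := le_one_add_mul_of_rpow_le hl0 hl1 hA hAA hB hBB hθ hθ1 hε0 hε1 (h1.trans hle)
  have hB3 := le_one_add_mul_of_rpow_le hl0' hl1' hB hBB hA hAA hθ hθ1 hε0 hε2 (by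
    rw [sub_sub_cancel, mul_comm, mul_comm (B ^ _)]; exact h1.trans hle)
  have hC := transportConst_nonneg m
  exact ⟨stability_of_le hFi hF'i hHi (fun r hr => hH.nonneg r hr.le) (fun r hr => hFF r hr.le)
      hA hFA hA'.symm hA3 hAA hM hMM (h1.trans hle) hle hθ hθ1 hεθ hC h2,
    stability_of_le hGi hG'i hHi (fun r hr => hH.nonneg r hr.le) (fun r hr => hGG r hr.le)
      hB hGB hB'.symm hB3 hBB hM hMM (h1.trans hle) hle hθ hθ1 hεθ hC h3⟩

-- The lower envelope `L` serves as the non-increasing middle function. Comparing `G` and `H` with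
-- `F` through `L` avoids proving `L` log-concave: a multiple of `F` can serve as the approximant,
-- and `H - L ≥ 0` has integral at most `ε M` by the inequality for `L`.
open Set in
lemma profile_stability_of_left {m : ℕ} {lam ε θ A B : ℝ} {F G H : ℝ → ℝ}
    (hl0 : 0 < lam) (hl1 : lam < 1) (hθ : 0 < θ) (hθ1 : θ ≤ 1)
    (hF : IsLogConcaveProfile F) (hG : IsLogConcaveProfile G) (hH0 : ∀ r, 0 ≤ r → 0 ≤ H r)
    (hFi : IntegrableOn (fun r => r ^ m * F r) (Ioi 0))
    (hGi : IntegrableOn (fun r => r ^ m * G r) (Ioi 0))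
    (hHi : IntegrableOn (fun r => r ^ m * H r) (Ioi 0)) (hA : 0 < A) (hB : 0 < B)
    (hFA : ∫ r in Ioi 0, r ^ m * F r = A) (hGB : ∫ r in Ioi 0, r ^ m * G r = B)
    (hPL : ∀ r s, 0 ≤ r → 0 ≤ s → F r ^ lam * G s ^ (1 - lam) ≤ H (lam * r + (1 - lam) * s))
    (hle : ∫ r in Ioi 0, r ^ m * H r ≤ (1 + ε) * (A ^ lam * B ^ (1 - lam)))
    (hε : ε ≤ min lam (1 - lam) * θ ^ 2) :
    ∫ r in Ioi 0, r ^ m * |G r - B / A * F r| ≤ 2 * transportConst m * θ * B ∧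
    ∫ r in Ioi 0, r ^ m * |H r - A ^ lam * B ^ (1 - lam) / A * F r| ≤
      (transportConst m + 1) * θ * ∫ r in Ioi 0, r ^ m * H r := by
  set L := lowerEnvelope lam F G with hL
  have hLH : ∀ r, 0 < r → L r ≤ H r := fun r hr =>
    lowerEnvelope_le hF hG hl0 hl1 hPL hr (hH0 r hr.le)
  have hL0 : ∀ r, 0 ≤ L r := lowerEnvelope_nonneg hF hG
  have hLa : Antitone L := lowerEnvelope_antitone hF hG hl0 hl1
  have hLi : IntegrableOn (fun r => r ^ m * L r) (Ioi 0) := by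
    refine Integrable.mono' hHi (AEStronglyMeasurable.mul (by fun_prop)
      hLa.measurable.aestronglyMeasurable) ?_
    filter_upwards [ae_restrict_mem measurableSet_Ioi] with r hr
    have hr0 : 0 < r := hr
    have h1 := hL0 r
    have h2 := hLH r hr
    rw [Real.norm_of_nonneg (by positivity)]
    gcongr
  have hLHint : ∫ r in Ioi 0, r ^ m * L r ≤ ∫ r in Ioi 0, r ^ m * H r :=
    setIntegral_mono_on hLi hHi measurableSet_Ioi fun r hr =>
      mul_le_mul_of_nonneg_left (hLH r hr) (pow_nonneg (le_of_lt hr) m)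
  obtain ⟨h1, h2, h3⟩ := profile_stability hl0 hl1 hθ hθ1 hF hG hFi hGi hA hB hFA hGB
    (fun ρ _ => hL0 ρ) (hLa.antitoneOn _) hLi
    (fun r s hr hs => le_lowerEnvelope hF hG hl0 hl1 hr hs le_rfl) (hLHint.trans hle) hε
  have hM := rpow_mul_rpow_one_sub_pos (lam := lam) hA hB
  set M := A ^ lam * B ^ (1 - lam) with hMd
  have hC := transportConst_nonneg m
  have hi : ∀ {K₁ K₂ : ℝ → ℝ}, IntegrableOn (fun r => r ^ m * K₁ r) (Ioi 0) →
      IntegrableOn (fun r => r ^ m * K₂ r) (Ioi 0) → ∀ c : ℝ,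
      IntegrableOn (fun r => r ^ m * |K₁ r - c * K₂ r|) (Ioi 0) := fun h h' c =>
    integrableOn_pow_mul_abs_sub subset_rfl measurableSet_Ioi h h' c
  constructor
  · have h4 : ∫ r in Ioi 0, r ^ m * |G r - B / A * F r| ≤
        ∫ r in Ioi 0, (r ^ m * |G r - B / M * L r| + B / A * (r ^ m * |F r - A / M * L r|)) := by
      refine setIntegral_mono_on (hi hGi hFi _) ((hi hGi hLi _).add ((hi hFi hLi _).const_mul _))
        measurableSet_Ioi fun r hr => ?_
      have h5 : 0 ≤ r ^ m := pow_nonneg (le_of_lt hr) m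
      have h6 : |G r - B / A * F r| ≤ |G r - B / M * L r| + B / A * |F r - A / M * L r| := by
        have h7 : G r - B / A * F r = (G r - B / M * L r) - B / A * (F r - A / M * L r) := by
          field_simp; ring
        rw [h7]
        refine (abs_sub _ _).trans ?_
        rw [abs_mul, abs_of_pos (by positivity : 0 < B / A)]
      calc r ^ m * |G r - B / A * F r| ≤
            r ^ m * (|G r - B / M * L r| + B / A * |F r - A / M * L r|) := by gcongr
        _ = _ := by ring
    rw [integral_add (hi hGi hLi _) ((hi hFi hLi _).const_mul _), integral_const_mul] at h4
    have h8 : B / A * ∫ r in Ioi 0, r ^ m * |F r - A / M * L r| ≤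
        B / A * (transportConst m * θ * A) := by gcongr
    have h9 : B / A * (transportConst m * θ * A) = transportConst m * θ * B := by field_simp
    linarith
  · have h4 : ∫ r in Ioi 0, r ^ m * |H r - M / A * F r| ≤
        ∫ r in Ioi 0, ((r ^ m * H r - r ^ m * L r) + M / A * (r ^ m * |F r - A / M * L r|)) := by
      refine setIntegral_mono_on (hi hHi hFi _) ((hHi.sub hLi).add ((hi hFi hLi _).const_mul _))
        measurableSet_Ioi fun r hr => ?_
      have h5 : 0 ≤ r ^ m := pow_nonneg (le_of_lt hr) m
      have h6 : |H r - M / A * F r| ≤ (H r - L r) + M / A * |F r - A / M * L r| := by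
        have h7 : H r - M / A * F r = (H r - L r) - M / A * (F r - A / M * L r) := by
          field_simp; ring
        rw [h7]
        refine (abs_sub _ _).trans ?_
        rw [abs_mul, abs_of_pos (by positivity : 0 < M / A),
          abs_of_nonneg (sub_nonneg.2 (hLH r hr))]
      calc r ^ m * |H r - M / A * F r| ≤
            r ^ m * ((H r - L r) + M / A * |F r - A / M * L r|) := by gcongr
        _ = _ := by ring
    rw [integral_add (f := fun r => r ^ m * H r - r ^ m * L r) (hHi.sub hLi)
      ((hi hFi hLi _).const_mul _), integral_sub hHi hLi, integral_const_mul] at h4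
    have h8 : M / A * ∫ r in Ioi 0, r ^ m * |F r - A / M * L r| ≤
        M / A * (transportConst m * θ * A) := by gcongr
    have h9 : M / A * (transportConst m * θ * A) = transportConst m * θ * M := by field_simp
    have h10 : ε ≤ θ := by
      have := min_le_left lam (1 - lam)
      nlinarith [sq_nonneg θ]
    have h11 : M ≤ ∫ r in Ioi 0, r ^ m * H r := h1.trans hLHint
    calc ∫ r in Ioi 0, r ^ m * |H r - M / A * F r| ≤ (transportConst m + 1) * θ * M := by
          nlinarith
      _ ≤ _ := by gcongr

/-! ### Polar coordinates and profiles of radial functions -/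

section Radial

variable {n : ℕ}

/-- The surface area of the unit sphere. -/
noncomputable def sphereArea (n : ℕ) : ℝ :=
  n * volume.real (Metric.ball (0 : EuclideanSpace ℝ (Fin n)) 1)

lemma sphereArea_pos (hn : 1 ≤ n) : 0 < sphereArea n := by
  have h1 : 0 < volume.real (Metric.ball (0 : EuclideanSpace ℝ (Fin n)) 1) :=
    ENNReal.toReal_pos (Metric.measure_ball_pos _ _ one_pos).ne' measure_ball_lt_top.ne
  have h2 : (0 : ℝ) < n := by exact_mod_cast hn
  exact mul_pos h2 h1

lemma nontrivial_euclideanSpace (hn : 1 ≤ n) : Nontrivial (EuclideanSpace ℝ (Fin n)) := by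
  have : Nonempty (Fin n) := ⟨⟨0, hn⟩⟩
  infer_instance

lemma integral_comp_norm (hn : 1 ≤ n) (φ : ℝ → ℝ) :
    ∫ x : EuclideanSpace ℝ (Fin n), φ ‖x‖ =
      sphereArea n * ∫ r in Set.Ioi 0, r ^ (n - 1) * φ r := by
  have := nontrivial_euclideanSpace hn
  rw [integral_fun_norm_addHaar volume φ, finrank_euclideanSpace_fin, nsmul_eq_mul, smul_eq_mul,
    sphereArea, mul_assoc]
  simp only [smul_eq_mul]

lemma integrable_comp_norm_iff (hn : 1 ≤ n) (φ : ℝ → ℝ) :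
    Integrable (fun x : EuclideanSpace ℝ (Fin n) => φ ‖x‖) ↔
      IntegrableOn (fun r => r ^ (n - 1) * φ r) (Set.Ioi 0) := by
  have := nontrivial_euclideanSpace hn
  rw [integrable_fun_norm_addHaar, finrank_euclideanSpace_fin]
  simp only [smul_eq_mul]

lemma exists_norm_eq_one_euclideanSpace (hn : 1 ≤ n) : ∃ e : EuclideanSpace ℝ (Fin n), ‖e‖ = 1 :=
  ⟨EuclideanSpace.single ⟨0, hn⟩ 1, by simp⟩

variable {e : EuclideanSpace ℝ (Fin n)} {f : EuclideanSpace ℝ (Fin n) → ℝ}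

lemma IsRadial.eq_profile (hf : IsRadial f) (he : ‖e‖ = 1) :
    f = fun x => (fun r : ℝ => f (r • e)) ‖x‖ := by
  ext x
  exact hf _ _ (by simp [norm_smul, he])

lemma IsLogConcave.profile (hf : IsLogConcave f) (hr : IsRadial f) :
    IsLogConcaveProfile fun r : ℝ => f (r • e) where
  nonneg r _ := hf.1 _
  antitoneOn := by
    intro r h₁ s h₂ h
    have hr0 : 0 ≤ r := h₁
    rcases h.eq_or_lt with rfl | hlt
    · exact le_rfl
    have hs0 : 0 < s := hr0.trans_lt hlt
    have h1 : f ((-s) • e) = f (s • e) := hr _ _ (by simp [norm_smul])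
    -- The point `r • e` lies between the antipodal points `± s • e`, where `f` takes the same
    -- value, so log-concavity gives `f (s • e) ≤ f (r • e)`.
    have h2 := hf.2 (s • e) ((-s) • e) ((1 + r / s) / 2) (by positivity) (by
      have : r / s < 1 := (div_lt_one hs0).2 hlt
      linarith)
    have h3 : ((1 + r / s) / 2) • s • e + (1 - (1 + r / s) / 2) • (-s) • e = r • e := by
      rw [smul_smul, smul_smul, ← add_smul]
      congr 1
      field_simp
      ring
    rw [h1, h3] at h2
    rcases (hf.1 (s • e)).eq_or_lt with h0 | h0
    · dsimp only; rw [← h0]; exact hf.1 _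
    · rwa [← Real.rpow_add h0, add_sub_cancel, Real.rpow_one] at h2
  logConcave r s t _ _ ht ht1 := by
    have h := hf.2 (r • e) (s • e) t ht ht1
    rwa [smul_smul, smul_smul, ← add_smul] at h

lemma IsLogConcave.const_mul (hf : IsLogConcave f) {c : ℝ} (hc : 0 < c) :
    IsLogConcave fun x => c * f x := by
  refine ⟨fun x => mul_nonneg hc.le (hf.1 x), fun x y t ht ht1 => ?_⟩
  dsimp only
  rw [Real.mul_rpow hc.le (hf.1 x), Real.mul_rpow hc.le (hf.1 y), mul_mul_mul_comm,
    ← Real.rpow_add hc, add_sub_cancel, Real.rpow_one]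
  exact mul_le_mul_of_nonneg_left (hf.2 x y t ht ht1) hc.le

end Radial

/-! ### The stability estimate -/

/-- Transport divides by `θ` and so needs `θ > 0`. Letting `θ` decrease to `θ₀` also covers `ε = 0`.
-/
lemma le_mul_of_forall_gt {X C A θ₀ : ℝ} (h0 : θ₀ < 1)
    (h : ∀ θ, θ₀ < θ → θ ≤ 1 → X ≤ C * θ * A) : X ≤ C * θ₀ * A := by
  have hc : Continuous fun θ : ℝ => C * θ * A := by fun_prop
  refine ge_of_tendsto ((hc.tendsto θ₀).mono_left (nhdsWithin_le_nhds (s := Set.Ioi θ₀))) ?_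
  filter_upwards [Ioc_mem_nhdsGT h0] with θ hθ using h θ hθ.1 hθ.2

lemma rpow_div_one_sub {A B lam : ℝ} (hA : 0 < A) (hB : 0 < B) :
    (A / B) ^ (1 - lam) = A / (A ^ lam * B ^ (1 - lam)) := by
  rw [Real.div_rpow hA.le hB.le, Real.rpow_sub hA, Real.rpow_one, div_div]

lemma rpow_div_neg {A B lam : ℝ} (hA : 0 < A) (hB : 0 < B) :
    (A / B) ^ (-lam) = B / (A ^ lam * B ^ (1 - lam)) := by
  have := Real.rpow_pos_of_pos hA lam
  have := Real.rpow_pos_of_pos hB lam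
  rw [Real.div_rpow hA.le hB.le, Real.rpow_neg hA.le, Real.rpow_neg hB.le, Real.rpow_sub hB,
    Real.rpow_one]
  field_simp

lemma radial_prekopaLeindler_stability {n : ℕ} (hn : 1 ≤ n) :
    ∃ C : ℝ, 0 < C ∧
      ∀ (lam ε : ℝ) (h f g : EuclideanSpace ℝ (Fin n) → ℝ),
        0 < lam → lam < 1 → 0 ≤ ε →
        (∀ x, 0 ≤ h x) → (∀ x, 0 ≤ f x) → (∀ x, 0 ≤ g x) →
        IsRadial h → IsRadial f → IsRadial g →
        Integrable h → Integrable f → Integrable g →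
        0 < ∫ x, f x → 0 < ∫ x, g x →
        PLCondition lam h f g →
        (IsLogConcave h ∨ (IsLogConcave f ∧ IsLogConcave g)) →
        PLAlmostEq lam ε h f g →
        ∃ (a : ℝ) (h' : EuclideanSpace ℝ (Fin n) → ℝ),
          0 < a ∧ IsRadial h' ∧ IsLogConcave h' ∧ Integrable h' ∧
          ∫ x, |f x - a ^ (1 - lam) * h' x|
            ≤ C * (ε / min lam (1 - lam)) ^ (1 / 2 : ℝ) * ∫ x, f x ∧
          ∫ x, |g x - a ^ (-lam) * h' x|
            ≤ C * (ε / min lam (1 - lam)) ^ (1 / 2 : ℝ) * ∫ x, g x ∧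
          ∫ x, |h x - h' x|
            ≤ C * (ε / min lam (1 - lam)) ^ (1 / 2 : ℝ) * ∫ x, h x := by
  have hT := transportConst_nonneg (n - 1)
  set T := transportConst (n - 1) with hTd
  refine ⟨3 * T + 6, by positivity, ?_⟩
  intro lam ε h f g hl0 hl1 hε0 hh0 hf0 hg0 hhr hfr hgr hhi hfi hgi hfp hgp hPL hLC hAE
  have ht0 : 0 < min lam (1 - lam) := lt_min hl0 (by linarith)
  set t₀ := min lam (1 - lam) with ht₀
  rw [← Real.sqrt_eq_rpow]
  set θ₀ := √(ε / t₀) with hθ₀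
  have hθ₀0 : 0 ≤ θ₀ := Real.sqrt_nonneg _
  have hθ₀sq : ε = t₀ * θ₀ ^ 2 := by
    rw [hθ₀, Real.sq_sqrt (by positivity)]; field_simp
  rcases le_or_gt 1 θ₀ with hbig | hsmall
  · -- the error bounds exceed the total masses
    have hC1 : 1 ≤ (3 * T + 6) * θ₀ := by nlinarith
    refine ⟨1, fun _ => 0, one_pos, fun _ _ _ => rfl, ⟨fun _ => le_rfl, fun _ _ t ht _ => ?_⟩,
      integrable_zero _ _ _, ?_, ?_, ?_⟩
    · rw [Real.zero_rpow ht.ne', zero_mul]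
    · simp only [mul_zero, sub_zero, abs_of_nonneg (hf0 _)]
      exact le_mul_of_one_le_left hfp.le hC1
    · simp only [mul_zero, sub_zero, abs_of_nonneg (hg0 _)]
      exact le_mul_of_one_le_left hgp.le hC1
    · simp only [sub_zero, abs_of_nonneg (hh0 _)]
      exact le_mul_of_one_le_left (integral_nonneg hh0) hC1
  obtain ⟨e, he⟩ := exists_norm_eq_one_euclideanSpace hn
  have hc := sphereArea_pos hn
  set c := sphereArea n with hcd
  set F : ℝ → ℝ := fun r => f (r • e) with hF
  set G : ℝ → ℝ := fun r => g (r • e) with hG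
  set H : ℝ → ℝ := fun r => h (r • e) with hH
  have hfF : f = fun x => F ‖x‖ := hfr.eq_profile he
  have hgG : g = fun x => G ‖x‖ := hgr.eq_profile he
  have hhH : h = fun x => H ‖x‖ := hhr.eq_profile he
  have hFi := (integrable_comp_norm_iff hn F).1 (hfF ▸ hfi)
  have hGi := (integrable_comp_norm_iff hn G).1 (hgG ▸ hgi)
  have hHi := (integrable_comp_norm_iff hn H).1 (hhH ▸ hhi)
  obtain ⟨A, hA⟩ : ∃ A, ∫ r in Set.Ioi 0, r ^ (n - 1) * F r = A := ⟨_, rfl⟩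
  obtain ⟨B, hB⟩ : ∃ B, ∫ r in Set.Ioi 0, r ^ (n - 1) * G r = B := ⟨_, rfl⟩
  have hfint : ∫ x, f x = c * A := by
    calc ∫ x, f x = ∫ x : EuclideanSpace ℝ (Fin n), F ‖x‖ := by rw [← hfF]
      _ = _ := by rw [integral_comp_norm hn F, hA]
  have hgint : ∫ x, g x = c * B := by
    calc ∫ x, g x = ∫ x : EuclideanSpace ℝ (Fin n), G ‖x‖ := by rw [← hgG]
      _ = _ := by rw [integral_comp_norm hn G, hB]
  have hhint : ∫ x, h x = c * ∫ r in Set.Ioi 0, r ^ (n - 1) * H r := by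
    calc ∫ x, h x = ∫ x : EuclideanSpace ℝ (Fin n), H ‖x‖ := by rw [← hhH]
      _ = _ := by rw [integral_comp_norm hn H]
  have hdiff : ∀ {k₁ k₂ : EuclideanSpace ℝ (Fin n) → ℝ}, IsRadial k₁ → IsRadial k₂ → ∀ b : ℝ,
      ∫ x, |k₁ x - b * k₂ x| =
        c * ∫ r in Set.Ioi (0 : ℝ), r ^ (n - 1) * |k₁ (r • e) - b * k₂ (r • e)| :=
      fun {k₁ k₂} h₁ h₂ b => by
    have hr : IsRadial fun x => |k₁ x - b * k₂ x| := fun x y hxy => by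
      dsimp only; rw [h₁ x y hxy, h₂ x y hxy]
    calc ∫ x, |k₁ x - b * k₂ x| = ∫ x : EuclideanSpace ℝ (Fin n),
          (fun r : ℝ => |k₁ (r • e) - b * k₂ (r • e)|) ‖x‖ := by
            exact congrArg (fun k => ∫ x, k x) (hr.eq_profile he)
      _ = _ := integral_comp_norm hn fun r : ℝ => |k₁ (r • e) - b * k₂ (r • e)|
  have hA0 : 0 < A := by rw [hfint] at hfp; exact (mul_pos_iff_of_pos_left hc).1 hfp
  have hB0 : 0 < B := by rw [hgint] at hgp; exact (mul_pos_iff_of_pos_left hc).1 hgp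
  have hM := rpow_mul_rpow_one_sub_pos (lam := lam) hA0 hB0
  have hPL' : ∀ r s, 0 ≤ r → 0 ≤ s →
      F r ^ lam * G s ^ (1 - lam) ≤ H (lam * r + (1 - lam) * s) := fun r s _ _ => by
    have h1 := hPL (r • e) (s • e)
    rwa [smul_smul, smul_smul, ← add_smul] at h1
  have hle : ∫ r in Set.Ioi 0, r ^ (n - 1) * H r ≤ (1 + ε) * (A ^ lam * B ^ (1 - lam)) := by
    unfold PLAlmostEq at hAE
    rw [hfint, hgint, hhint, Real.mul_rpow hc.le hA0.le, Real.mul_rpow hc.le hB0.le,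
      mul_mul_mul_comm, ← Real.rpow_add hc, add_sub_cancel, Real.rpow_one] at hAE
    refine le_of_mul_le_mul_left (hAE.trans_eq ?_) hc
    ring
  have hεθ : ∀ θ, θ₀ < θ → ε ≤ t₀ * θ ^ 2 := fun θ hθ => by
    rw [hθ₀sq]; gcongr
  have hF0 : ∀ r, 0 ≤ r → 0 ≤ F r := fun r _ => hf0 _
  have hG0 : ∀ r, 0 ≤ r → 0 ≤ G r := fun r _ => hg0 _
  have hH0 : ∀ r, 0 ≤ r → 0 ≤ H r := fun r _ => hh0 _
  by_cases hhLC : IsLogConcave h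
  -- The choice `a = A / B` makes `a ^ (1 - lam)` and `a ^ (-lam)` equal to `A / M` and `B / M`,
  -- where `M = A ^ lam B ^ (1 - lam)`; these are the coefficients in the profile estimates.
  · refine ⟨A / B, h, by positivity, hhr, hhLC, hhi, ?_, ?_, ?_⟩
    · rw [rpow_div_one_sub hA0 hB0, hfint, hdiff hfr hhr]
      refine le_mul_of_forall_gt hsmall fun θ h1 h2 => ?_
      have h3 := (profile_stability_of_right hl0 hl1 (hθ₀0.trans_lt h1) h2 hε0 hF0 hG0
        (hhLC.profile hhr) hFi hGi hHi hA0 hB0 hA hB hPL' hle (hεθ θ h1)).1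
      calc _ ≤ c * ((3 * T + 6) * θ * A) := by gcongr
        _ = _ := by ring
    · rw [rpow_div_neg hA0 hB0, hgint, hdiff hgr hhr]
      refine le_mul_of_forall_gt hsmall fun θ h1 h2 => ?_
      have h3 := (profile_stability_of_right hl0 hl1 (hθ₀0.trans_lt h1) h2 hε0 hF0 hG0
        (hhLC.profile hhr) hFi hGi hHi hA0 hB0 hA hB hPL' hle (hεθ θ h1)).2
      calc _ ≤ c * ((3 * T + 6) * θ * B) := by gcongr
        _ = _ := by ring
    · simp only [sub_self, abs_zero, integral_zero]
      have := integral_nonneg (μ := volume) (f := h) fun x => hh0 x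
      positivity
  · obtain ⟨hfLC, hgLC⟩ := hLC.resolve_left hhLC
    set M := A ^ lam * B ^ (1 - lam) with hMd
    have hstab := fun θ (h1 : θ₀ < θ) (h2 : θ ≤ 1) =>
      profile_stability_of_left hl0 hl1 (hθ₀0.trans_lt h1) h2
        (hfLC.profile hfr) (hgLC.profile hgr) hH0 hFi hGi hHi hA0 hB0 hA hB hPL' hle
        (hεθ θ h1)
    -- The multiple of `f` is chosen so that its error for `f` vanishes exactly.
    refine ⟨A / B, fun x => M / A * f x, by positivity,
      fun x y hxy => by dsimp only; rw [hfr x y hxy], hfLC.const_mul (by positivity),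
      hfi.const_mul _, ?_, ?_, ?_⟩
    · have h1 : ∀ x, f x - (A / B) ^ (1 - lam) * (M / A * f x) = 0 := fun x => by
        rw [rpow_div_one_sub hA0 hB0, ← hMd, ← mul_assoc,
          show A / M * (M / A) = 1 by field_simp, one_mul, sub_self]
      simp only [h1, abs_zero, integral_zero]
      positivity
    · have h1 : ∀ x, g x - (A / B) ^ (-lam) * (M / A * f x) = g x - B / A * f x := fun x => by
        rw [rpow_div_neg hA0 hB0, ← hMd, ← mul_assoc, show B / M * (M / A) = B / A by field_simp]
      simp only [h1]
      rw [hgint, hdiff hgr hfr]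
      refine le_mul_of_forall_gt hsmall fun θ h1 h2 => ?_
      have hθ := hθ₀0.trans_lt h1
      calc _ ≤ c * (2 * T * θ * B) := by gcongr; exact (hstab θ h1 h2).1
        _ ≤ c * ((3 * T + 6) * θ * B) := by gcongr; linarith
        _ = _ := by ring
    · rw [hhint, hdiff hhr hfr]
      have hHint0 : 0 ≤ ∫ r in Set.Ioi 0, r ^ (n - 1) * H r :=
        setIntegral_nonneg measurableSet_Ioi fun r hr =>
          mul_nonneg (pow_nonneg (le_of_lt hr) _) (hh0 _)
      refine le_mul_of_forall_gt hsmall fun θ h1 h2 => ?_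
      have hθ := hθ₀0.trans_lt h1
      calc _ ≤ c * ((T + 1) * θ * ∫ r in Set.Ioi 0, r ^ (n - 1) * H r) := by
            gcongr; exact (hstab θ h1 h2).2
        _ ≤ c * ((3 * T + 6) * θ * ∫ r in Set.Ioi 0, r ^ (n - 1) * H r) := by
            gcongr <;> linarith
        _ = _ := by ring

/-! ### Balls and sharpness of the order -/

section Ball

variable {n : ℕ}

/-- The indicator function of the closed ball of radius `ρ` around the origin. -/
noncomputable def ballIndicator (n : ℕ) (ρ : ℝ) : EuclideanSpace ℝ (Fin n) → ℝ :=
  (Metric.closedBall 0 ρ).indicator fun _ => 1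

lemma ballIndicator_of_le {ρ : ℝ} {x : EuclideanSpace ℝ (Fin n)} (h : ‖x‖ ≤ ρ) :
    ballIndicator n ρ x = 1 := Set.indicator_of_mem (mem_closedBall_zero_iff.2 h) _

lemma ballIndicator_of_lt {ρ : ℝ} {x : EuclideanSpace ℝ (Fin n)} (h : ρ < ‖x‖) :
    ballIndicator n ρ x = 0 :=
  Set.indicator_of_notMem (fun hx => (mem_closedBall_zero_iff.1 hx).not_gt h) _

lemma ballIndicator_nonneg (ρ : ℝ) (x : EuclideanSpace ℝ (Fin n)) : 0 ≤ ballIndicator n ρ x :=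
  Set.indicator_nonneg (fun _ _ => zero_le_one) x

lemma isRadial_ballIndicator (ρ : ℝ) : IsRadial (ballIndicator n ρ) := fun x y h => by
  rcases le_or_gt ‖x‖ ρ with hx | hx
  · rw [ballIndicator_of_le hx, ballIndicator_of_le (h ▸ hx)]
  · rw [ballIndicator_of_lt hx, ballIndicator_of_lt (h ▸ hx)]

lemma norm_combo_le {x y : EuclideanSpace ℝ (Fin n)} {ρ₁ ρ₂ t : ℝ} (ht : 0 ≤ t) (ht1 : t ≤ 1)
    (hx : ‖x‖ ≤ ρ₁) (hy : ‖y‖ ≤ ρ₂) : ‖t • x + (1 - t) • y‖ ≤ t * ρ₁ + (1 - t) * ρ₂ := by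
  have h1 : 0 ≤ 1 - t := by linarith
  calc ‖t • x + (1 - t) • y‖ ≤ ‖t • x‖ + ‖(1 - t) • y‖ := norm_add_le _ _
    _ = t * ‖x‖ + (1 - t) * ‖y‖ := by
        rw [norm_smul, norm_smul, Real.norm_of_nonneg ht, Real.norm_of_nonneg h1]
    _ ≤ _ := by gcongr

lemma plCondition_ballIndicator {ρ₁ ρ₂ t : ℝ} (ht : 0 < t) (ht1 : t < 1) :
    PLCondition t (ballIndicator n (t * ρ₁ + (1 - t) * ρ₂)) (ballIndicator n ρ₁)
      (ballIndicator n ρ₂) := fun x y => by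
  rcases le_or_gt ‖x‖ ρ₁ with hx | hx
  · rcases le_or_gt ‖y‖ ρ₂ with hy | hy
    · rw [ballIndicator_of_le hx, ballIndicator_of_le hy,
        ballIndicator_of_le (norm_combo_le ht.le ht1.le hx hy), Real.one_rpow, Real.one_rpow,
        one_mul]
    · rw [ballIndicator_of_lt hy, Real.zero_rpow (by linarith), mul_zero]
      exact ballIndicator_nonneg _ _
  · rw [ballIndicator_of_lt hx, Real.zero_rpow (by linarith), zero_mul]
    exact ballIndicator_nonneg _ _

lemma isLogConcave_ballIndicator (ρ : ℝ) : IsLogConcave (ballIndicator n ρ) := by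
  refine ⟨ballIndicator_nonneg ρ, fun x y t ht ht1 => ?_⟩
  have h := plCondition_ballIndicator (n := n) (ρ₁ := ρ) (ρ₂ := ρ) ht ht1 x y
  rwa [← add_mul, add_sub_cancel, one_mul] at h

lemma integrable_ballIndicator (ρ : ℝ) : Integrable (ballIndicator n ρ) :=
  (integrable_indicator_iff Metric.isClosed_closedBall.measurableSet).2
    (integrableOn_const measure_closedBall_lt_top.ne)

lemma integral_ballIndicator {ρ : ℝ} (hρ : 0 ≤ ρ) :
    ∫ x, ballIndicator n ρ x =
      ρ ^ n * volume.real (Metric.closedBall (0 : EuclideanSpace ℝ (Fin n)) 1) := by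
  unfold ballIndicator
  rw [integral_indicator Metric.isClosed_closedBall.measurableSet, setIntegral_const, smul_eq_mul,
    mul_one, Measure.addHaar_real_closedBall' _ _ hρ, finrank_euclideanSpace_fin]

lemma volume_real_closedBall_pos :
    0 < volume.real (Metric.closedBall (0 : EuclideanSpace ℝ (Fin n)) 1) :=
  ENNReal.toReal_pos (Metric.measure_closedBall_pos _ _ one_pos).ne' measure_closedBall_lt_top.ne

lemma integral_abs_ballIndicator_sub {ρ₁ ρ₂ a : ℝ} (hρ : 0 ≤ ρ₁) (h : ρ₁ ≤ ρ₂) (u v : ℝ)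
    (hu : |u| = a) :
    ∫ x, |v * ballIndicator n ρ₁ x + u * ballIndicator n ρ₂ x| =
      (|v + u| * ρ₁ ^ n + a * (ρ₂ ^ n - ρ₁ ^ n)) *
        volume.real (Metric.closedBall (0 : EuclideanSpace ℝ (Fin n)) 1) := by
  have h1 : ∀ x : EuclideanSpace ℝ (Fin n), |v * ballIndicator n ρ₁ x + u * ballIndicator n ρ₂ x| =
      |v + u| * ballIndicator n ρ₁ x + a * (ballIndicator n ρ₂ x - ballIndicator n ρ₁ x) := by
    intro x
    rcases le_or_gt ‖x‖ ρ₁ with hx | hx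
    · simp [ballIndicator_of_le hx, ballIndicator_of_le (hx.trans h)]
    · rcases le_or_gt ‖x‖ ρ₂ with hx' | hx'
      · simp [ballIndicator_of_lt hx, ballIndicator_of_le hx', hu]
      · simp [ballIndicator_of_lt hx, ballIndicator_of_lt hx']
  have hi := fun ρ => integrable_ballIndicator (n := n) ρ
  simp only [h1]
  rw [integral_add (g := fun x => a * (ballIndicator n ρ₂ x - ballIndicator n ρ₁ x))
      ((hi _).const_mul _) (((hi _).sub (hi _)).const_mul _), integral_const_mul,
    integral_const_mul, integral_sub (hi _) (hi _), integral_ballIndicator hρ,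
    integral_ballIndicator (hρ.trans h)]
  ring

/-- Two functions that are far from proportional cannot both be close to multiples of a third. -/
lemma far_of_not_proportional {f g h' : EuclideanSpace ℝ (Fin n) → ℝ} {a lam κ : ℝ} (ha : 0 < a)
    (hf : Integrable f) (hg : Integrable g) (hh' : Integrable h')
    (h : κ * (∫ x, f x) + a * (κ * ∫ x, g x) ≤ ∫ x, |f x - a * g x|) :
    κ * ∫ x, f x ≤ ∫ x, |f x - a ^ (1 - lam) * h' x| ∨
      κ * ∫ x, g x ≤ ∫ x, |g x - a ^ (-lam) * h' x| := by
  by_contra! hc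
  have hi₁ : Integrable fun x => |f x - a ^ (1 - lam) * h' x| := (hf.sub (hh'.const_mul _)).abs
  have hi₂ : Integrable fun x => |g x - a ^ (-lam) * h' x| := (hg.sub (hh'.const_mul _)).abs
  have hi₃ : Integrable fun x => |f x - a * g x| := (hf.sub (hg.const_mul _)).abs
  have hpow : a ^ (1 - lam) = a * a ^ (-lam) := by
    rw [sub_eq_add_neg, Real.rpow_add ha, Real.rpow_one]
  have h1 : ∫ x, |f x - a * g x| ≤
      ∫ x, (|f x - a ^ (1 - lam) * h' x| + a * |g x - a ^ (-lam) * h' x|) := by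
    refine integral_mono hi₃ (hi₁.add (hi₂.const_mul a)) fun x => ?_
    have h2 : f x - a * g x =
        (f x - a ^ (1 - lam) * h' x) - a * (g x - a ^ (-lam) * h' x) := by rw [hpow]; ring
    dsimp only
    rw [h2]
    refine (abs_sub _ _).trans ?_
    rw [abs_mul, abs_of_pos ha]
  rw [integral_add hi₁ (hi₂.const_mul a), integral_const_mul] at h1
  have h3 := mul_lt_mul_of_pos_left hc.2 ha
  linarith [hc.1]

end Ball

/-- Taking logarithms, the first-order terms `n t η` cancel and at most `n t η ^ 2 / 2` is left,
while `log (1 + ε) ≥ ε / 2` for `ε ≤ 1`. -/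
lemma amgm_deficit_le {n : ℕ} (hn : 1 ≤ n) {t ε η : ℝ} (ht : 0 < t) (hη : 0 ≤ η)
    (hε0 : 0 ≤ ε) (hε1 : ε ≤ 1) (h : n * t * η ^ 2 ≤ ε) :
    (1 + t * η) ^ n ≤ (1 + ε) * ((1 + η) ^ n) ^ t := by
  have h1 : 0 < 1 + η := by linarith
  have h2 : 0 < 1 + t * η := by positivity
  have h3 : 0 < 1 + ε := by linarith
  rw [← Real.log_le_log_iff (by positivity) (by positivity),
    Real.log_mul (by positivity) (by positivity), Real.log_rpow (by positivity), Real.log_pow,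
    Real.log_pow]
  have h4 : Real.log (1 + t * η) ≤ t * η := by
    have := Real.log_le_sub_one_of_pos h2; linarith
  have h5 : ε / 2 ≤ Real.log (1 + ε) := by
    refine le_trans ?_ (Real.le_log_one_add_of_nonneg hε0)
    rw [div_le_div_iff₀ (by norm_num) (by linarith)]; nlinarith
  have h6 : η - η ^ 2 / 2 ≤ Real.log (1 + η) := by
    refine le_trans ?_ (Real.le_log_one_add_of_nonneg hη)
    rw [le_div_iff₀ (by linarith)]
    nlinarith [mul_nonneg hη (sq_nonneg η)]
  have hn0 : (0 : ℝ) < n := by exact_mod_cast hn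
  have h7 : (n : ℝ) * Real.log (1 + t * η) ≤ n * (t * η) := by gcongr
  have h8 : t * (n * (η - η ^ 2 / 2)) ≤ t * (n * Real.log (1 + η)) := by gcongr
  nlinarith

lemma radial_prekopaLeindler_sharp {n : ℕ} (hn : 1 ≤ n) :
    ∃ c ε₀ : ℝ, 0 < c ∧ 0 < ε₀ ∧
      ∀ lam ε : ℝ, 0 < lam → lam < 1 → 0 < ε → ε ≤ ε₀ * min lam (1 - lam) →
        ∃ h f g : EuclideanSpace ℝ (Fin n) → ℝ,
          IsRadial h ∧ IsRadial f ∧ IsRadial g ∧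
          IsLogConcave h ∧ IsLogConcave f ∧ IsLogConcave g ∧
          Integrable h ∧ Integrable f ∧ Integrable g ∧
          0 < ∫ x, f x ∧ 0 < ∫ x, g x ∧
          PLCondition lam h f g ∧ PLAlmostEq lam ε h f g ∧
          ∀ (a : ℝ) (h' : EuclideanSpace ℝ (Fin n) → ℝ),
            0 < a → IsRadial h' → IsLogConcave h' → Integrable h' →
            c * (ε / min lam (1 - lam)) ^ (1 / 2 : ℝ) * ∫ x, f x
                ≤ ∫ x, |f x - a ^ (1 - lam) * h' x| ∨
            c * (ε / min lam (1 - lam)) ^ (1 / 2 : ℝ) * ∫ x, g x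
                ≤ ∫ x, |g x - a ^ (-lam) * h' x| := by
  have hn0 : (0 : ℝ) < n := by exact_mod_cast hn
  have hn1 : (1 : ℝ) ≤ n := by exact_mod_cast hn
  refine ⟨1 / ((1 + 2 ^ n) * √n), 1, by positivity, one_pos, fun lam ε hl0 hl1 hε hεt => ?_⟩
  have ht0 : 0 < min lam (1 - lam) := lt_min hl0 (by linarith)
  have ht1 := min_le_left lam (1 - lam)
  rw [← Real.sqrt_eq_rpow]
  set t := min lam (1 - lam) with ht
  -- Chosen so that `n t η ^ 2 = ε`, the largest radius perturbation `amgm_deficit_le` permits.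
  set η := √(ε / t) / √n with hη
  have hη0 : 0 < η := by positivity
  have hηsq : n * t * η ^ 2 = ε := by
    rw [hη, div_pow, Real.sq_sqrt (by positivity), Real.sq_sqrt hn0.le]; field_simp
  have hη1 : η ≤ 1 := by
    rw [hη, div_le_one (by positivity)]
    refine Real.sqrt_le_sqrt (le_trans ?_ hn1)
    rw [div_le_one ht0]; linarith
  have hκ : 1 / ((1 + 2 ^ n) * √n) * √(ε / t) = η / (1 + 2 ^ n) := by
    rw [hη]; field_simp
  rw [hκ]
  set V := volume.real (Metric.closedBall (0 : EuclideanSpace ℝ (Fin n)) 1) with hV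
  have hV0 : 0 < V := volume_real_closedBall_pos
  have hdef : (1 + t * η) ^ n ≤ (1 + ε) * ((1 + η) ^ n) ^ t :=
    amgm_deficit_le hn ht0 hη0.le hε.le (by linarith) hηsq.le
  have hpow2 : (1 + η) ^ n ≤ 2 ^ n := by gcongr; linarith
  have hpow1 : 1 + η ≤ (1 + η) ^ n := le_self_pow₀ (by linarith) (by omega)
  have hbig : ∀ a : ℝ, 0 < a → ∀ p q : ℝ, p ≤ 2 ^ n → q ≤ 2 ^ n → (p ≤ 1 ∨ q ≤ 1) →
      η / (1 + 2 ^ n) * p + a * (η / (1 + 2 ^ n) * q) ≤ η * max 1 a := fun a ha p q hp hq hpq => by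
    have h1 : p + a * q ≤ (1 + 2 ^ n) * max 1 a := by
      have h2 := le_max_left 1 a
      have h3 := le_max_right 1 a
      have h4 : (0 : ℝ) < 2 ^ n := by positivity
      have h5 : a * q ≤ max 1 a * 2 ^ n := by
        calc a * q ≤ a * 2 ^ n := by gcongr
          _ ≤ _ := by gcongr
      have h6 : p ≤ max 1 a * 2 ^ n := by nlinarith
      rcases hpq with h | h
      · linarith
      · have : a * q ≤ a * 1 := by gcongr
        linarith
    calc η / (1 + 2 ^ n) * p + a * (η / (1 + 2 ^ n) * q) = η / (1 + 2 ^ n) * (p + a * q) := by ring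
      _ ≤ η / (1 + 2 ^ n) * ((1 + 2 ^ n) * max 1 a) := by gcongr
      _ = _ := by field_simp
  -- No multiple helps: matching heights leaves the shell of relative size `η`, and any other `a`
  -- pays `|1 - a|` on the unit ball. Both bounds use `η ≤ 1`.
  have hmax : ∀ a : ℝ, 0 < a → η * max 1 a ≤ |1 - a| + a * η ∧ η * max 1 a ≤ |1 - a| + η :=
    fun a ha => by
      rcases le_total a 1 with h | h
      · rw [max_eq_left h, abs_of_nonneg (by linarith)]; constructor <;> nlinarith
      · rw [max_eq_right h, abs_of_nonpos (by linarith)]; constructor <;> nlinarith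
  suffices hexists : ∃ ρ₁ ρ₂ : ℝ, 0 < ρ₁ ∧ 0 < ρ₂ ∧
      (lam * ρ₁ + (1 - lam) * ρ₂) ^ n ≤ (1 + ε) * ((ρ₁ ^ n) ^ lam * (ρ₂ ^ n) ^ (1 - lam)) ∧
      ∀ a : ℝ, 0 < a → η / (1 + 2 ^ n) * (ρ₁ ^ n * V) + a * (η / (1 + 2 ^ n) * (ρ₂ ^ n * V)) ≤
        ∫ x, |ballIndicator n ρ₁ x - a * ballIndicator n ρ₂ x| by
    obtain ⟨ρ₁, ρ₂, h₁, h₂, hd, hs⟩ := hexists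
    exact ⟨ballIndicator n (lam * ρ₁ + (1 - lam) * ρ₂), ballIndicator n ρ₁, ballIndicator n ρ₂,
      isRadial_ballIndicator _, isRadial_ballIndicator _, isRadial_ballIndicator _,
      isLogConcave_ballIndicator _, isLogConcave_ballIndicator _, isLogConcave_ballIndicator _,
      integrable_ballIndicator _, integrable_ballIndicator _, integrable_ballIndicator _,
      by rw [integral_ballIndicator h₁.le]; positivity,
      by rw [integral_ballIndicator h₂.le]; positivity,
      plCondition_ballIndicator hl0 hl1,
      by
        have h3 : 0 ≤ 1 - lam := by linarith
        unfold PLAlmostEq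
        rw [integral_ballIndicator (by positivity), integral_ballIndicator h₁.le,
          integral_ballIndicator h₂.le, Real.mul_rpow (by positivity) hV0.le,
          Real.mul_rpow (by positivity) hV0.le, mul_mul_mul_comm, ← Real.rpow_add hV0,
          add_sub_cancel, Real.rpow_one, ← mul_assoc]
        gcongr,
      fun a h' ha _ _ hh' => far_of_not_proportional ha (integrable_ballIndicator _)
        (integrable_ballIndicator _) hh' (by
          rw [integral_ballIndicator h₁.le, integral_ballIndicator h₂.le]; exact hs a ha)⟩
  -- The larger ball goes to the function with the smaller weight, so that the middle radius is `1 +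
  -- t η`.
  rcases le_total lam (1 - lam) with hlam | hlam
  · have htl : t = lam := min_eq_left hlam
    refine ⟨1 + η, 1, by linarith, one_pos, ?_, fun a ha => ?_⟩
    · rw [one_pow, Real.one_rpow, mul_one, mul_one, ← htl]
      convert hdef using 2
      ring
    · have h1 := integral_abs_ballIndicator_sub (n := n) (a := 1) zero_le_one
        (by linarith : (1 : ℝ) ≤ 1 + η) 1 (-a) (by simp)
      have h2 : ∀ x : EuclideanSpace ℝ (Fin n), ballIndicator n (1 + η) x - a * ballIndicator n 1 x =
          -a * ballIndicator n 1 x + 1 * ballIndicator n (1 + η) x := fun x => by ring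
      simp only [h2]
      rw [h1, ← hV, one_pow]
      have h3 := hbig a ha ((1 + η) ^ n) 1 hpow2 (one_le_pow₀ (by norm_num)) (Or.inr le_rfl)
      have h4 := (hmax a ha).2
      rw [show -a + 1 = 1 - a by ring]
      calc _ = (η / (1 + 2 ^ n) * (1 + η) ^ n + a * (η / (1 + 2 ^ n) * 1)) * V := by ring
        _ ≤ _ := mul_le_mul_of_nonneg_right (by linarith) hV0.le
  · have htl : t = 1 - lam := min_eq_right hlam
    refine ⟨1, 1 + η, one_pos, by linarith, ?_, fun a ha => ?_⟩
    · rw [one_pow, Real.one_rpow, one_mul, ← htl]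
      convert hdef using 2
      rw [htl]; ring
    · have h1 := integral_abs_ballIndicator_sub (n := n) (a := a) zero_le_one
        (by linarith : (1 : ℝ) ≤ 1 + η) (-a) 1 (by rw [abs_neg, abs_of_pos ha])
      have h2 : ∀ x : EuclideanSpace ℝ (Fin n), ballIndicator n 1 x - a * ballIndicator n (1 + η) x =
          1 * ballIndicator n 1 x + -a * ballIndicator n (1 + η) x := fun x => by ring
      simp only [h2]
      rw [h1, ← hV, one_pow]
      have h3 := hbig a ha 1 ((1 + η) ^ n) (one_le_pow₀ (by norm_num)) hpow2 (Or.inl le_rfl)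
      have h4 := (hmax a ha).1
      have h5 : a * η ≤ a * ((1 + η) ^ n - 1) := by gcongr; linarith
      rw [show 1 + -a = 1 - a by ring]
      calc _ = (η / (1 + 2 ^ n) * 1 + a * (η / (1 + 2 ^ n) * (1 + η) ^ n)) * V := by ring
        _ ≤ _ := mul_le_mul_of_nonneg_right (by linarith) hV0.le

theorem theorem3 (n : ℕ) (hn : 1 ≤ n) :
    -- stability
    (∃ C : ℝ, 0 < C ∧
      ∀ (lam ε : ℝ) (h f g : EuclideanSpace ℝ (Fin n) → ℝ),
        0 < lam → lam < 1 → 0 ≤ ε →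
        (∀ x, 0 ≤ h x) → (∀ x, 0 ≤ f x) → (∀ x, 0 ≤ g x) →
        IsRadial h → IsRadial f → IsRadial g →
        Integrable h → Integrable f → Integrable g →
        0 < ∫ x, f x → 0 < ∫ x, g x →
        PLCondition lam h f g →
        (IsLogConcave h ∨ (IsLogConcave f ∧ IsLogConcave g)) →
        PLAlmostEq lam ε h f g →
        ∃ (a : ℝ) (h' : EuclideanSpace ℝ (Fin n) → ℝ),
          0 < a ∧ IsRadial h' ∧ IsLogConcave h' ∧ Integrable h' ∧
          ∫ x, |f x - a ^ (1 - lam) * h' x|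
            ≤ C * (ε / min lam (1 - lam)) ^ (1 / 2 : ℝ) * ∫ x, f x ∧
          ∫ x, |g x - a ^ (-lam) * h' x|
            ≤ C * (ε / min lam (1 - lam)) ^ (1 / 2 : ℝ) * ∫ x, g x ∧
          ∫ x, |h x - h' x|
            ≤ C * (ε / min lam (1 - lam)) ^ (1 / 2 : ℝ) * ∫ x, h x) ∧
    -- sharpness of the order of the error
    (∃ c ε₀ : ℝ, 0 < c ∧ 0 < ε₀ ∧
      ∀ lam ε : ℝ, 0 < lam → lam < 1 → 0 < ε → ε ≤ ε₀ * min lam (1 - lam) →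
        ∃ h f g : EuclideanSpace ℝ (Fin n) → ℝ,
          IsRadial h ∧ IsRadial f ∧ IsRadial g ∧
          IsLogConcave h ∧ IsLogConcave f ∧ IsLogConcave g ∧
          Integrable h ∧ Integrable f ∧ Integrable g ∧
          0 < ∫ x, f x ∧ 0 < ∫ x, g x ∧
          PLCondition lam h f g ∧ PLAlmostEq lam ε h f g ∧
          ∀ (a : ℝ) (h' : EuclideanSpace ℝ (Fin n) → ℝ),
            0 < a → IsRadial h' → IsLogConcave h' → Integrable h' →
            c * (ε / min lam (1 - lam)) ^ (1 / 2 : ℝ) * ∫ x, f x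
                ≤ ∫ x, |f x - a ^ (1 - lam) * h' x| ∨
            c * (ε / min lam (1 - lam)) ^ (1 / 2 : ℝ) * ∫ x, g x
                ≤ ∫ x, |g x - a ^ (-lam) * h' x|) := by
  exact ⟨radial_prekopaLeindler_stability hn, radial_prekopaLeindler_sharp hn⟩
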